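/- Let $p$ be a prime, $K$ a finite unramified extension of $\mathbb Q_p$ with ring of integers $\mathcal O_K$ and $p$-th Frobenius $\sigma$ (so $\sigma(x)\equiv x^p \pmod p$ on $\mathcal O_K$), and fix an algebraic closure of $K$. Let $P(x)=b_dx^d+\cdots+b_0\in\mathbb Z_p[x]$ with $b_d$ a unit, all of whose zeros have valuation $>0$ and $<1$. Let $f(X)=X^p+\alpha_{p-1}X^{p-1}+\cdots+\alpha_1X\in\mathcal O_K[X]$ with $p\mid\alpha_i$ for $1\le i\le p-1$ and $v_p(\alpha_1)=1$. A superscript $\sigma^m$ on a polynomial or power series means that $\sigma^m$ is applied to its coefficients. Put $j(x)=P(x)/b_0-1$. For a polynomial $g\in K[X]$ without constant term let $\varphi_g$ be the operator on $K[[X]]$ that acts as $\sigma$ on coefficients and sends $X$ to $g(X)$, and let $$l(X)=\bigl[1-j(\varphi_f)+j(\varphi_f)^2-\cdots\bigr]\circ X\in K[[X]],$$ the sum being taken coefficientwise. On $K$, let $F$ act as $\sigma$, let $$j(F)^{-1}=\frac{b_0}{b_d}F^{-d}\Bigl(1+\frac{b_{d-1}}{b_d}F^{-1}+\cdots+\frac{b_1}{b_d}F^{-(d-1)}\Bigr)^{-1},$$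 with the last factor expanded as a geometric series, and for $m\in\mathbb Z$ let $$\epsilon^{\sigma^m}=\bigl(-j(F)^{-1}+j(F)^{-2}-\cdots\bigr)\Bigl(-\frac{\alpha_{p-1}^{\sigma^m}}{p}\Bigr)\in K.$$ Let $\pi_0=0$ and let $\pi_n\neq0$ $(n\ge1)$ be elements of the algebraic closure with $f^{\sigma^{-n}}(\pi_n)=\pi_{n-1}$; then $K(\pi_m)\subseteq K(\pi_n)$ for $m\le n$, and we write $\operatorname{Tr}_{n/m}=\operatorname{Tr}_{K(\pi_n)/K(\pi_m)}$. Then, for all integers $n>d$ and $0\le i<d$, all the infinite series above converge, the power series $\varphi^{\,i}_{f^{\sigma^{-n+s}}}\circ l^{\sigma^{-n+s}}$ converges at $\pi_{n-s}$ for $0\le s\le d$, and $$\sum_{s=0}^{d}p^s\,b_s\operatorname{Tr}_{n-s/n-d}\Bigl(\epsilon^{\sigma^{-n+s+i}}+\bigl(\varphi^{\,i}_{f^{\sigma^{-n+s}}}\circ l^{\sigma^{-n+s}}\bigr)(\pi_{n-s})\Bigr)=0 .$$ -/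

import Mathlib

open scoped PowerSeries Polynomial IntermediateField

noncomputable section

namespace Lubin

variable {p : ℕ} [Fact p.Prime]

/-- The finite extension `K / ℚ_p` (inside the algebraic closure of `ℚ_p`, with the norm extending
the `p`-adic one) is unramified: the maximal ideal of its ring of integers is generated by `p`.
(Its residue field is finite, so the residue extension is automatically separable.) -/
def IsUnramified (K : IntermediateField ℚ_[p] (PadicAlgCl p)) : Prop :=
  ∀ x : K, ‖(x : PadicAlgCl p)‖ < 1 → ‖(x : PadicAlgCl p)‖ ≤ ‖(p : PadicAlgCl p)‖

/-- `σ` is the `p`-th Frobenius map of `K`: `σ x ≡ x ^ p` modulo `p` on the ring of integers. -/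
def IsFrobenius {K : IntermediateField ℚ_[p] (PadicAlgCl p)} (σ : K ≃ₐ[ℚ_[p]] K) : Prop :=
  ∀ x : K, ‖(x : PadicAlgCl p)‖ ≤ 1 →
    ‖((σ x - x ^ p : K) : PadicAlgCl p)‖ ≤ ‖(p : PadicAlgCl p)‖

/-- `P ∈ ℤ_p[x]` has a unit as leading coefficient, and all its zeros (in the algebraic closure)
have valuation strictly between `0` and `1`. -/
structure IsAdmissible (P : ℤ_[p][X]) : Prop where
  leadingCoeff : IsUnit P.leadingCoeff
  zeros : ∀ z : PadicAlgCl p, P.eval₂ ((algebraMap ℚ_[p] (PadicAlgCl p)).comp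
    (algebraMap ℤ_[p] ℚ_[p])) z = 0 → ‖(p : PadicAlgCl p)‖ < ‖z‖ ∧ ‖z‖ < 1

/-- `f = X ^ p + α_{p-1} X ^ (p-1) + ⋯ + α_1 X` with all `α_i` integral and divisible by `p`
and with `v_p(α_1) = 1`. -/
structure IsFrobeniusLift {K : IntermediateField ℚ_[p] (PadicAlgCl p)} (f : K[X]) : Prop where
  monic : f.Monic
  natDegree : f.natDegree = p
  coeff_zero : f.coeff 0 = 0
  coeff_le : ∀ i, 1 ≤ i → i < p → ‖(f.coeff i : PadicAlgCl p)‖ ≤ ‖(p : PadicAlgCl p)‖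
  coeff_one : ‖(f.coeff 1 : PadicAlgCl p)‖ = ‖(p : PadicAlgCl p)‖

section Operators

variable {K : IntermediateField ℚ_[p] (PadicAlgCl p)}

/-- The coefficient `b_i` of `P`, as an element of `ℚ_p`. -/
def b (P : ℤ_[p][X]) (i : ℕ) : ℚ_[p] := (P.coeff i : ℚ_[p])

/-- `f ^ {σ ^ m}`: apply `σ ^ m` to the coefficients of the polynomial `f`. -/
def twist (σ : K ≃ₐ[ℚ_[p]] K) (m : ℤ) (f : K[X]) : K[X] :=
  f.map ((σ ^ m : K ≃ₐ[ℚ_[p]] K) : K →+* K)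

/-- `g ^ {σ ^ m}`: apply `σ ^ m` to the coefficients of the power series `g`. -/
def twistSeries (σ : K ≃ₐ[ℚ_[p]] K) (m : ℤ) (g : K⟦X⟧) : K⟦X⟧ :=
  g.map ((σ ^ m : K ≃ₐ[ℚ_[p]] K) : K →+* K)

/-- The operator `∑_{i=1}^{d-1} (b_{d-i} / b_d) F^{-i}` on `K`, where `F` acts as `σ`,
that is `F^{-1} = V / p` with `V x = p σ^{-1}(x)`. -/
def uOp (σ : K ≃ₐ[ℚ_[p]] K) (P : ℤ_[p][X]) (x : K) : K :=
  ∑ i ∈ Finset.Ico 1 P.natDegree,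
    (b P (P.natDegree - i) / b P P.natDegree) • (σ ^ (-(i : ℤ)) : K ≃ₐ[ℚ_[p]] K) x

/-- The `k`-th term of the expansion of `(1 + u)⁻¹ x`, where `u` is the operator `uOp`. -/
def geomTerm (σ : K ≃ₐ[ℚ_[p]] K) (P : ℤ_[p][X]) (x : K) (k : ℕ) : K :=
  (-1) ^ k * (uOp σ P)^[k] x

/-- The operator `j(F)⁻¹ = (b_0 / b_d) F^{-d} (1 + u)⁻¹` on `K`, with `(1 + u)⁻¹` expanded as a
geometric series. -/
def jInv (σ : K ≃ₐ[ℚ_[p]] K) (P : ℤ_[p][X]) (x : K) : K :=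
  (b P 0 / b P P.natDegree) •
    (σ ^ (-(P.natDegree : ℤ)) : K ≃ₐ[ℚ_[p]] K) (∑' k, geomTerm σ P x k)

/-- The `k`-th term (`k = 0, 1, …`) of the series
`(-j(F)⁻¹ + j(F)⁻² - ⋯) (-α_{p-1}^{σ^m} / p)`. -/
def epsTerm (σ : K ≃ₐ[ℚ_[p]] K) (P : ℤ_[p][X]) (f : K[X]) (m : ℤ) (k : ℕ) : K :=
  (-1) ^ (k + 1) * (jInv σ P)^[k + 1] (-((σ ^ m : K ≃ₐ[ℚ_[p]] K) (f.coeff (p - 1)) / (p : K)))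

/-- The constant `ε ^ {σ ^ m}`. -/
def eps (σ : K ≃ₐ[ℚ_[p]] K) (P : ℤ_[p][X]) (f : K[X]) (m : ℤ) : K :=
  ∑' k, epsTerm σ P f m k

/-- The operator `φ_f` on power series: `σ` on coefficients and `X ↦ f(X)`
(for `f` without constant term). -/
def phi (σ : K ≃ₐ[ℚ_[p]] K) (f : K[X]) (g : K⟦X⟧) : K⟦X⟧ :=
  (twistSeries σ 1 g).subst (f : K⟦X⟧)

/-- The operator `j(φ_f)`, where `j(x) = P(x) / b_0 - 1 = ∑_{i=1}^d (b_i / b_0) x ^ i`. -/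
def jPhi (σ : K ≃ₐ[ℚ_[p]] K) (P : ℤ_[p][X]) (f : K[X]) (g : K⟦X⟧) : K⟦X⟧ :=
  ∑ i ∈ Finset.Icc 1 P.natDegree, (b P i / b P 0) • (phi σ f)^[i] g

/-- The term `(-1) ^ k j(φ_f) ^ k ∘ X` of the series defining `l`. -/
def lTerm (σ : K ≃ₐ[ℚ_[p]] K) (P : ℤ_[p][X]) (f : K[X]) (k : ℕ) : K⟦X⟧ :=
  (-1) ^ k * (jPhi σ P f)^[k] PowerSeries.X

/-- The logarithm-type series `l = [1 - j(φ_f) + j(φ_f) ^ 2 - ⋯] ∘ X`, summed coefficientwise. -/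
def lSeries (σ : K ≃ₐ[ℚ_[p]] K) (P : ℤ_[p][X]) (f : K[X]) : K⟦X⟧ :=
  PowerSeries.mk fun N => ∑' k, PowerSeries.coeff N (lTerm σ P f k)

/-- The power series `φ_{f^{σ^m}} ^ i ∘ l ^ {σ ^ m}`. -/
def phiL (σ : K ≃ₐ[ℚ_[p]] K) (P : ℤ_[p][X]) (f : K[X]) (m : ℤ) (i : ℕ) : K⟦X⟧ :=
  (phi σ (twist σ m f))^[i] (twistSeries σ m (lSeries σ P f))

/-- `π_0 = 0`, and `π_n ≠ 0`, `f^{σ^{-n}}(π_n) = π_{n-1}` for `n ≥ 1`. -/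
structure IsTorsionSequence (σ : K ≃ₐ[ℚ_[p]] K) (f : K[X]) (π : ℕ → PadicAlgCl p) : Prop where
  zero : π 0 = 0
  ne_zero : ∀ n, 1 ≤ n → π n ≠ 0
  eval : ∀ n, 1 ≤ n → Polynomial.aeval (π n) (twist σ (-(n : ℤ)) f) = π (n - 1)

theorem IsTorsionSequence.adjoin_le {σ : K ≃ₐ[ℚ_[p]] K} {f : K[X]} {π : ℕ → PadicAlgCl p}
    (h : IsTorsionSequence σ f π) {m n : ℕ} (hmn : m ≤ n) : K⟮π m⟯ ≤ K⟮π n⟯ := by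
  induction n, hmn using Nat.le_induction with
  | base => exact le_rfl
  | succ n _ ih =>
    refine ih.trans (IntermediateField.adjoin_simple_le_iff.2 ?_)
    have h1 := h.eval (n + 1) (Nat.le_add_left 1 n)
    rw [Nat.add_sub_cancel] at h1
    rw [← h1]
    exact Subalgebra.aeval_coe (K⟮π (n + 1)⟯).toSubalgebra
      ⟨π (n + 1), IntermediateField.mem_adjoin_simple_self K (π (n + 1))⟩ _ ▸ Subtype.coe_prop _

/-- `Tr_{n/m}`, the trace from `K(π_n)` to `K(π_m)` for `m ≤ n`. -/
def Tr {σ : K ≃ₐ[ℚ_[p]] K} {f : K[X]} {π : ℕ → PadicAlgCl p}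
    (h : IsTorsionSequence σ f π) {m n : ℕ} (hmn : m ≤ n) (x : K⟮π n⟯) : K⟮π m⟯ :=
  Algebra.trace K⟮π m⟯ (IntermediateField.extendScalars (h.adjoin_le hmn)) ⟨x, x.2⟩

/-- The terms of the series `g(x)` for a power series `g` over `K` and `x` in an extension. -/
def substTerm {E : IntermediateField K (PadicAlgCl p)} (g : K⟦X⟧) (x : E) (N : ℕ) : E :=
  algebraMap K E (PowerSeries.coeff N g) * x ^ N

/-- `ε^{σ^{m+i}} + (φ_{f^{σ^m}} ^ i ∘ l^{σ^m})(x)` for `x` in an extension of `K`. -/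
def value {E : IntermediateField K (PadicAlgCl p)} (σ : K ≃ₐ[ℚ_[p]] K) (P : ℤ_[p][X])
    (f : K[X]) (m : ℤ) (i : ℕ) (x : E) : E :=
  algebraMap K E (eps σ P f (m + i)) + ∑' N, substTerm (phiL σ P f m i) x N

end Operators

end Lubin

end

/-! Since P = b_0 (1 + j), the series l inverts 1 + j(φ_f) at X, that is ∑ b_s φ_f^s(l) = b_0 X.
Apply σ^{-n} to the coefficients, then φ^i, and evaluate at π_n. Under evaluation each φ moves the
point one step down the torsion sequence and twists the series by σ, so the relation becomes ∑ b_s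
(φ^i l^{σ^{-n+s}})(π_{n-s}) = b_0 π_{n-i} (`sum_smul_tsum_phiL`). In the same way ε inverts 1 +
j(F), expanded in negative powers of F, and ∑ b_s ε^{σ^{-n+s+i}} = b_0 a/p with a =
α_{p-1}^{σ^{-n+i}} (`sum_smul_eps`).

Adding the two and tracing down to K(π_{n-d}) gives the theorem. On the left, [K(π_n) : K(π_{n-s})]
= p^s produces the factors p^s. On the right, π_{n-i} has minimal polynomial f^{σ^{-n+i}} -
π_{n-i-1} over K(π_{n-i-1}), hence trace -a there, and this cancels the contribution of a/p
(`relTrace_sum_smul_value`).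

Convergence comes from the zeros of P. Valuation < 1 gives |b_i| p^{-i} < |b_0|, which beats the
contraction of discs by f and makes l converge on the open unit disc. Valuation > 0 gives |b_i| <
|b_d| for i < d, which makes j(F)^{-1} a contraction. The degrees come from |π_{k+1}|^{(p-1)p^k} =
1/p and the value group p^ℤ of K. -/

noncomputable section

namespace Lubin

/-! ### Growth of power series coefficients on discs -/

section Bounded

variable {k : Type*} [NormedField k]

/-- The coefficients `a_N` of `g` satisfy `‖a_N‖ r ^ N ≤ C`. -/
def BoundedOn (r C : ℝ) (g : k⟦X⟧) : Prop :=
  ∀ N, ‖PowerSeries.coeff N g‖ * r ^ N ≤ C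

theorem BoundedOn.nonneg {r C : ℝ} {g : k⟦X⟧} (h : BoundedOn r C g) : 0 ≤ C :=
  le_trans (by simp) (h 0)

theorem BoundedOn.mono {r C D : ℝ} {g : k⟦X⟧} (h : BoundedOn r C g) (hCD : C ≤ D) :
    BoundedOn r D g := fun N => (h N).trans hCD

theorem BoundedOn.neg {r C : ℝ} {g : k⟦X⟧} (h : BoundedOn r C g) : BoundedOn r C (-g) :=
  fun N => by simpa using h N

theorem boundedOn_one {r : ℝ} : BoundedOn r 1 (1 : k⟦X⟧) := by
  intro N
  rw [PowerSeries.coeff_one]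
  split_ifs with h <;> simp [h]

theorem boundedOn_X {r : ℝ} (hr : 0 ≤ r) : BoundedOn r r (PowerSeries.X : k⟦X⟧) := by
  intro N
  rw [PowerSeries.coeff_X]
  split_ifs with h <;> simp [h, hr]

variable [IsUltrametricDist k]

theorem BoundedOn.sum {ι : Type*} {s : Finset ι} {g : ι → k⟦X⟧} {r C : ℝ} (hr : 0 ≤ r)
    (hC : 0 ≤ C) (h : ∀ i ∈ s, BoundedOn r C (g i)) : BoundedOn r C (∑ i ∈ s, g i) := by
  intro N
  rw [map_sum]
  obtain rfl | hs := s.eq_empty_or_nonempty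
  · simpa using hC
  · obtain ⟨i, hi, hle⟩ := IsUltrametricDist.exists_norm_finsetSum_le_of_nonempty hs
      (fun i => PowerSeries.coeff N (g i))
    exact (mul_le_mul_of_nonneg_right hle (pow_nonneg hr N)).trans (h i hi N)

theorem BoundedOn.mul {r C D : ℝ} {g h : k⟦X⟧} (hr : 0 ≤ r) (hg : BoundedOn r C g)
    (hh : BoundedOn r D h) : BoundedOn r (C * D) (g * h) := by
  intro N
  rw [PowerSeries.coeff_mul]
  obtain ⟨i, hi, hle⟩ := IsUltrametricDist.exists_norm_finsetSum_le_of_nonempty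
    (t := Finset.HasAntidiagonal.antidiagonal N) ⟨(0, N), by simp⟩
    (fun i => PowerSeries.coeff i.1 g * PowerSeries.coeff i.2 h)
  refine (mul_le_mul_of_nonneg_right hle (pow_nonneg hr N)).trans ?_
  rw [← Finset.HasAntidiagonal.mem_antidiagonal.1 hi, norm_mul, pow_add, mul_mul_mul_comm]
  exact mul_le_mul (hg _) (hh _) (by positivity) hg.nonneg

theorem BoundedOn.pow {r C : ℝ} {g : k⟦X⟧} (hr : 0 ≤ r) (hg : BoundedOn r C g) (n : ℕ) :
    BoundedOn r (C ^ n) (g ^ n) := by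
  induction n with
  | zero => simpa using boundedOn_one
  | succ n ih => simpa only [pow_succ] using ih.mul hr hg

/-- The power series `g` converges on the open unit disc. -/
def ConvergesOnDisc (g : k⟦X⟧) : Prop :=
  ∀ r : ℝ, 0 < r → r < 1 → ∃ C, BoundedOn r C g

end Bounded

/-! ### Frobenius twists and the operator φ_f -/

section Frobenius

variable {p : ℕ} [Fact p.Prime] {K : IntermediateField ℚ_[p] (PadicAlgCl p)}

/-- The norm is the spectral norm, which depends only on the minimal polynomial over ℚ_p. -/
theorem norm_algEquiv (σ : K ≃ₐ[ℚ_[p]] K) (x : K) : ‖σ x‖ = ‖x‖ := by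
  change ‖((σ x : K) : PadicAlgCl p)‖ = ‖(x : PadicAlgCl p)‖
  have h (y : K) : minpoly ℚ_[p] (y : PadicAlgCl p) = minpoly ℚ_[p] y :=
    minpoly.algebraMap_eq (B := K) (B' := PadicAlgCl p) Subtype.val_injective y
  rw [← PadicAlgCl.spectralNorm_eq, ← PadicAlgCl.spectralNorm_eq, spectralNorm, spectralNorm,
    h, h, minpoly.algEquiv_eq]

theorem algEquiv_smul (σ : K ≃ₐ[ℚ_[p]] K) (c : ℚ_[p]) (x : K) : σ (c • x) = c • σ x :=
  σ.toLinearMap.map_smul c x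

theorem continuous_algEquiv (σ : K ≃ₐ[ℚ_[p]] K) : Continuous σ :=
  (AddMonoidHomClass.isometry_of_norm σ (norm_algEquiv σ)).continuous

theorem norm_natCast_prime : ‖(p : PadicAlgCl p)‖ = (p : ℝ)⁻¹ := by
  rw [← Padic.norm_p (p := p), ← PadicAlgCl.norm_extends]
  simp

theorem norm_smul_padic (c : ℚ_[p]) (x : K) : ‖c • x‖ = ‖c‖ * ‖x‖ := norm_smul c x

theorem BoundedOn.smul {r C : ℝ} {g : K⟦X⟧} (h : BoundedOn r C g) (c : ℚ_[p]) :
    BoundedOn r (‖c‖ * C) (c • g) := by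
  intro N
  have : PowerSeries.coeff N (c • g) = c • PowerSeries.coeff N g := rfl
  rw [this, norm_smul, mul_assoc]
  exact mul_le_mul_of_nonneg_left (h N) (norm_nonneg _)

theorem coeff_smul_padic (c : ℚ_[p]) (g : K⟦X⟧) (N : ℕ) :
    PowerSeries.coeff N (c • g) = c • PowerSeries.coeff N g := rfl

@[simp] theorem coeff_twistSeries (σ : K ≃ₐ[ℚ_[p]] K) (m : ℤ) (g : K⟦X⟧) (N : ℕ) :
    PowerSeries.coeff N (twistSeries σ m g) = (σ ^ m : K ≃ₐ[ℚ_[p]] K) (PowerSeries.coeff N g) :=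
  rfl

@[simp] theorem coeff_twist (σ : K ≃ₐ[ℚ_[p]] K) (m : ℤ) (f : K[X]) (N : ℕ) :
    (twist σ m f).coeff N = (σ ^ m : K ≃ₐ[ℚ_[p]] K) (f.coeff N) :=
  Polynomial.coeff_map _ _

theorem zpow_add_apply (σ : K ≃ₐ[ℚ_[p]] K) (a b : ℤ) (x : K) :
    (σ ^ (a + b) : K ≃ₐ[ℚ_[p]] K) x
      = (σ ^ a : K ≃ₐ[ℚ_[p]] K) ((σ ^ b : K ≃ₐ[ℚ_[p]] K) x) := by
  rw [zpow_add]; rfl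

theorem twistSeries_twistSeries (σ : K ≃ₐ[ℚ_[p]] K) (a b : ℤ) (g : K⟦X⟧) :
    twistSeries σ a (twistSeries σ b g) = twistSeries σ (a + b) g := by
  ext1 N
  simp [zpow_add_apply]

theorem twistSeries_zero (σ : K ≃ₐ[ℚ_[p]] K) (g : K⟦X⟧) : twistSeries σ 0 g = g := by
  ext1 N
  simp

theorem twist_twist (σ : K ≃ₐ[ℚ_[p]] K) (a b : ℤ) (f : K[X]) :
    twist σ a (twist σ b f) = twist σ (a + b) f := by
  ext1 N
  simp only [coeff_twist, zpow_add_apply]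

theorem coe_twist (σ : K ≃ₐ[ℚ_[p]] K) (m : ℤ) (f : K[X]) :
    ((twist σ m f : K[X]) : K⟦X⟧) = twistSeries σ m f := by
  ext1 N
  simp

theorem BoundedOn.twistSeries {r C : ℝ} {g : K⟦X⟧} (h : BoundedOn r C g) (σ : K ≃ₐ[ℚ_[p]] K)
    (m : ℤ) : BoundedOn r C (twistSeries σ m g) := by
  intro N
  rw [coeff_twistSeries, norm_algEquiv]
  exact h N

theorem ConvergesOnDisc.twistSeries {g : K⟦X⟧} (h : ConvergesOnDisc g) (σ : K ≃ₐ[ℚ_[p]] K)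
    (m : ℤ) : ConvergesOnDisc (twistSeries σ m g) := fun r h0 h1 =>
  (h r h0 h1).imp fun _ hC => hC.twistSeries σ m

theorem coeff_pow_eq_zero {f : K[X]} (hf : f.coeff 0 = 0) {N j : ℕ} (h : N < j) :
    PowerSeries.coeff N ((f : K⟦X⟧) ^ j) = 0 := by
  refine PowerSeries.coeff_of_lt_order _ (lt_of_lt_of_le ?_ (PowerSeries.le_order_pow_of_constantCoeff_eq_zero j ?_))
  · exact_mod_cast h
  · simpa using hf

/-- The sum is finite because f has no constant term, so f^j starts in degree at least j. -/
theorem coeff_phi (σ : K ≃ₐ[ℚ_[p]] K) {f : K[X]} (hf : f.coeff 0 = 0) (g : K⟦X⟧) (N : ℕ) :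
    PowerSeries.coeff N (phi σ f g) = ∑ j ∈ Finset.range (N + 1),
      σ (PowerSeries.coeff j g) * PowerSeries.coeff N ((f : K⟦X⟧) ^ j) := by
  have hs : PowerSeries.HasSubst (f : K⟦X⟧) :=
    PowerSeries.HasSubst.of_constantCoeff_zero' (by simpa using hf)
  rw [phi, PowerSeries.coeff_subst' hs, finsum_eq_sum_of_support_subset (s := Finset.range (N + 1))]
  · simp
  · intro j hj
    by_contra hlt
    exact hj (by simp only; rw [coeff_pow_eq_zero hf (by simpa using hlt), smul_zero])

/-- If f has Gauss norm at most s on the disc of radius r, then f^j has Gauss norm at most s^j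
there, and σ is isometric. -/
theorem BoundedOn.phi {r s C : ℝ} (hr : 0 ≤ r) (σ : K ≃ₐ[ℚ_[p]] K) {f : K[X]}
    (hf : f.coeff 0 = 0) (hfb : BoundedOn r s (f : K⟦X⟧)) {g : K⟦X⟧} (hg : BoundedOn s C g) :
    BoundedOn r C (phi σ f g) := by
  intro N
  rw [coeff_phi σ hf]
  obtain ⟨j, -, hle⟩ := IsUltrametricDist.exists_norm_finsetSum_le_of_nonempty
    (t := Finset.range (N + 1)) (by simp)
    (fun j => σ (PowerSeries.coeff j g) * PowerSeries.coeff N ((f : K⟦X⟧) ^ j))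
  refine (mul_le_mul_of_nonneg_right hle (pow_nonneg hr N)).trans ?_
  rw [norm_mul, norm_algEquiv, mul_assoc]
  exact (mul_le_mul_of_nonneg_left (hfb.pow hr j N) (norm_nonneg _)).trans (hg j)

section Linear

variable (σ : K ≃ₐ[ℚ_[p]] K) {f : K[X]} (hf : f.coeff 0 = 0)

/-- The operator `φ_f` as a `ℚ_p`-linear map. -/
def phiLin : K⟦X⟧ →ₗ[ℚ_[p]] K⟦X⟧ where
  toFun := phi σ f
  map_add' g h := by
    ext1 N
    simp [coeff_phi σ hf, add_mul, Finset.sum_add_distrib]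
  map_smul' c g := by
    ext1 N
    simp only [coeff_phi σ hf, coeff_smul_padic, Finset.smul_sum, RingHom.id_apply]
    refine Finset.sum_congr rfl fun j _ => ?_
    rw [algEquiv_smul, smul_mul_assoc]

theorem phiLin_pow_apply (i : ℕ) (g : K⟦X⟧) : (phiLin σ hf ^ i) g = (phi σ f)^[i] g := by
  rw [Module.End.pow_apply]; rfl

/-- The operator `j(φ_f)` as a `ℚ_p`-linear map. -/
def jPhiLin (P : ℤ_[p][X]) : K⟦X⟧ →ₗ[ℚ_[p]] K⟦X⟧ :=
  ∑ i ∈ Finset.Icc 1 P.natDegree, (b P i / b P 0) • phiLin σ hf ^ i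

theorem jPhiLin_apply (P : ℤ_[p][X]) (g : K⟦X⟧) : jPhiLin σ hf P g = jPhi σ P f g := by
  simp [jPhiLin, jPhi, phiLin_pow_apply]

end Linear

/-- Powers of σ commute, so conjugating φ_f by σ^m only twists f. -/
theorem twistSeries_phi (σ : K ≃ₐ[ℚ_[p]] K) (m : ℤ) {f : K[X]} (hf : f.coeff 0 = 0) (g : K⟦X⟧) :
    twistSeries σ m (phi σ f g) = phi σ (twist σ m f) (twistSeries σ m g) := by
  ext1 N
  have h0 : (twist σ m f).coeff 0 = 0 := by simp [hf]
  rw [coeff_twistSeries, coeff_phi σ hf, coeff_phi σ h0, map_sum]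
  refine Finset.sum_congr rfl fun j _ => ?_
  have hpow : ((twist σ m f : K[X]) : K⟦X⟧) ^ j = twistSeries σ m ((f : K⟦X⟧) ^ j) := by
    rw [coe_twist, twistSeries, twistSeries, map_pow]
  rw [hpow, map_mul, coeff_twistSeries, coeff_twistSeries]
  congr 1
  have := zpow_add_apply σ m 1 (PowerSeries.coeff j g)
  rw [add_comm, zpow_add_apply] at this
  simpa using this.symm

theorem twistSeries_phi_iterate (σ : K ≃ₐ[ℚ_[p]] K) (m : ℤ) {f : K[X]} (hf : f.coeff 0 = 0)
    (i : ℕ) (g : K⟦X⟧) :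
    twistSeries σ m ((phi σ f)^[i] g) = (phi σ (twist σ m f))^[i] (twistSeries σ m g) := by
  induction i with
  | zero => rfl
  | succ i ih =>
    rw [Function.iterate_succ_apply', twistSeries_phi σ m hf, ih, Function.iterate_succ_apply']

/-- The series `∑ G k` converges to `g` coefficientwise. -/
def CoeffHasSum (G : ℕ → K⟦X⟧) (g : K⟦X⟧) : Prop :=
  ∀ N, HasSum (fun k => PowerSeries.coeff N (G k)) (PowerSeries.coeff N g)

/-- Each coefficient of φ_f(g) is a finite combination of σ-images of coefficients of g, so
coefficientwise convergence suffices. -/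
theorem CoeffHasSum.phi (σ : K ≃ₐ[ℚ_[p]] K) {f : K[X]} (hf : f.coeff 0 = 0) {G : ℕ → K⟦X⟧}
    {g : K⟦X⟧} (h : CoeffHasSum G g) : CoeffHasSum (fun k => Lubin.phi σ f (G k)) (Lubin.phi σ f g) := by
  intro N
  simp only [coeff_phi σ hf]
  exact hasSum_sum fun j _ => ((h j).map σ (continuous_algEquiv σ)).mul_right _

theorem CoeffHasSum.phi_iterate (σ : K ≃ₐ[ℚ_[p]] K) {f : K[X]} (hf : f.coeff 0 = 0)
    {G : ℕ → K⟦X⟧} {g : K⟦X⟧} (h : CoeffHasSum G g) (i : ℕ) :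
    CoeffHasSum (fun k => (Lubin.phi σ f)^[i] (G k)) ((Lubin.phi σ f)^[i] g) := by
  induction i with
  | zero => exact h
  | succ i ih => simpa only [Function.iterate_succ_apply'] using ih.phi σ hf

theorem CoeffHasSum.jPhi (σ : K ≃ₐ[ℚ_[p]] K) (P : ℤ_[p][X]) {f : K[X]} (hf : f.coeff 0 = 0)
    {G : ℕ → K⟦X⟧} {g : K⟦X⟧} (h : CoeffHasSum G g) :
    CoeffHasSum (fun k => Lubin.jPhi σ P f (G k)) (Lubin.jPhi σ P f g) := by
  intro N
  simp only [Lubin.jPhi, map_sum, coeff_smul_padic]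
  exact hasSum_sum fun i _ => (h.phi_iterate σ hf i N).const_smul _

end Frobenius

/-! ### Zeros of P, contraction of discs, and convergence of l -/

section Convergence

/-- The radius of the image under a Frobenius lift of the disc of radius `r`. -/
def imageRadius (p : ℕ) (r : ℝ) : ℝ := max (r ^ p) (r * (p : ℝ)⁻¹)

theorem imageRadius_pos {p : ℕ} {r : ℝ} (hr : 0 < r) : 0 < imageRadius p r :=
  lt_of_lt_of_le (pow_pos hr p) (le_max_left _ _)

section Roots

variable {k : Type*} [NormedField k]

theorem coeff_X_sub_C_mul_succ (z : k) (Q : k[X]) (i : ℕ) :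
    ((Polynomial.X - Polynomial.C z) * Q).coeff (i + 1) = Q.coeff i - z * Q.coeff (i + 1) := by
  rw [sub_mul, Polynomial.coeff_sub, Polynomial.coeff_X_mul, Polynomial.coeff_C_mul]

theorem coeff_X_sub_C_mul_zero (z : k) (Q : k[X]) :
    ((Polynomial.X - Polynomial.C z) * Q).coeff 0 = -(z * Q.coeff 0) := by
  rw [sub_mul, Polynomial.coeff_sub, Polynomial.coeff_X_mul_zero, Polynomial.coeff_C_mul, zero_sub]

variable [IsUltrametricDist k]

theorem norm_sub_le_max_norm (x y : k) : ‖x - y‖ ≤ max ‖x‖ ‖y‖ := by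
  simpa [sub_eq_add_neg] using IsUltrametricDist.norm_add_le_max x (-y)

/-- Modulo the elements of norm < 1 the product is X^card; roots are multiplied in one at a time. -/
theorem norm_coeff_prod_le_one (s : Multiset k) (hs : ∀ z ∈ s, ‖z‖ < 1) (i : ℕ) :
    ‖((s.map fun z => Polynomial.X - Polynomial.C z).prod).coeff i‖ ≤ 1 ∧
      (i < s.card → ‖((s.map fun z => Polynomial.X - Polynomial.C z).prod).coeff i‖ < 1) := by
  induction s using Multiset.induction_on generalizing i with
  | empty =>
    simp only [Multiset.map_zero, Multiset.prod_zero, Polynomial.coeff_one]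
    split_ifs <;> simp
  | cons z s ih =>
    have hz := hs z (Multiset.mem_cons_self z s)
    have ih := ih fun y hy => hs y (Multiset.mem_cons_of_mem hy)
    have hlt (j : ℕ) : ‖z * ((s.map fun z => Polynomial.X - Polynomial.C z).prod).coeff j‖ < 1 := by
      rw [norm_mul]
      exact mul_lt_one_of_nonneg_of_lt_one_left (norm_nonneg _) hz (ih j).1
    rw [Multiset.map_cons, Multiset.prod_cons, Multiset.card_cons]
    cases i with
    | zero =>
      rw [coeff_X_sub_C_mul_zero, norm_neg]
      exact ⟨(hlt 0).le, fun _ => hlt 0⟩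
    | succ i =>
      rw [coeff_X_sub_C_mul_succ]
      refine ⟨(norm_sub_le_max_norm _ _).trans (max_le (ih i).1 (hlt _).le), fun hi => ?_⟩
      exact (norm_sub_le_max_norm _ _).trans_lt (max_lt ((ih i).2 (by omega)) (hlt _))

/-- A coefficient of degree i + 1 is a sum of products of roots with i + 1 roots omitted, and each
omitted root has norm greater than c. -/
theorem norm_coeff_prod_mul_pow_lt {c : ℝ} (hc : 0 < c) (s : Multiset k)
    (hs : ∀ z ∈ s, c < ‖z‖) (i : ℕ) :
    ‖((s.map fun z => Polynomial.X - Polynomial.C z).prod).coeff (i + 1)‖ * c ^ (i + 1) <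
      ‖((s.map fun z => Polynomial.X - Polynomial.C z).prod).coeff 0‖ := by
  induction s using Multiset.induction_on generalizing i with
  | empty => simp [Polynomial.coeff_one]
  | cons z s ih =>
    have hz := hs z (Multiset.mem_cons_self z s)
    have ih := ih fun y hy => hs y (Multiset.mem_cons_of_mem hy)
    rw [Multiset.map_cons, Multiset.prod_cons]
    set Q := (s.map fun z => Polynomial.X - Polynomial.C z).prod
    have hle (j : ℕ) : ‖Q.coeff j‖ * c ^ j ≤ ‖Q.coeff 0‖ := by
      cases j with
      | zero => simp
      | succ j => exact (ih j).le
    have h0 : 0 < ‖Q.coeff 0‖ := lt_of_le_of_lt (by positivity) (ih 0)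
    rw [coeff_X_sub_C_mul_zero, norm_neg, coeff_X_sub_C_mul_succ, norm_mul]
    refine (mul_le_mul_of_nonneg_right (norm_sub_le_max_norm _ _) (by positivity)).trans_lt ?_
    rw [max_mul_of_nonneg _ _ (by positivity)]
    refine max_lt ?_ ?_
    · calc ‖Q.coeff i‖ * c ^ (i + 1) = c * (‖Q.coeff i‖ * c ^ i) := by ring
        _ ≤ c * ‖Q.coeff 0‖ := by gcongr; exact hle i
        _ < ‖z‖ * ‖Q.coeff 0‖ := by gcongr
    · rw [norm_mul, mul_assoc]
      exact mul_lt_mul_of_pos_left (ih i) (hc.trans hz)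

end Roots

variable {p : ℕ} [Fact p.Prime]

theorem prime_inv_pos : 0 < (p : ℝ)⁻¹ :=
  inv_pos.2 (Nat.cast_pos.2 (Fact.out : p.Prime).pos)

theorem prime_inv_lt_one : (p : ℝ)⁻¹ < 1 :=
  inv_lt_one_of_one_lt₀ (Nat.one_lt_cast.2 (Fact.out : p.Prime).one_lt)

theorem IsAdmissible.leading_ne_zero {P : ℤ_[p][X]} (hP : IsAdmissible P) :
    b P P.natDegree ≠ 0 := by
  have h := hP.leadingCoeff.ne_zero
  exact fun h0 => h (Subtype.ext h0)

theorem IsAdmissible.exists_roots {P : ℤ_[p][X]} (hP : IsAdmissible P) :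
    ∃ s : Multiset (PadicAlgCl p), s.card = P.natDegree ∧
      (∀ z ∈ s, (p : ℝ)⁻¹ < ‖z‖ ∧ ‖z‖ < 1) ∧
      ∀ i, algebraMap ℚ_[p] (PadicAlgCl p) (b P i) =
        algebraMap ℚ_[p] (PadicAlgCl p) (b P P.natDegree) *
          ((s.map fun z => Polynomial.X - Polynomial.C z).prod).coeff i := by
  set φ := (algebraMap ℚ_[p] (PadicAlgCl p)).comp (algebraMap ℤ_[p] ℚ_[p])
  have hinj : Function.Injective φ :=
    (algebraMap ℚ_[p] (PadicAlgCl p)).injective.comp (IsFractionRing.injective ℤ_[p] ℚ_[p])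
  have hsplit := IsAlgClosed.splits (P.map φ)
  refine ⟨(P.map φ).roots, ?_, fun z hz => ?_, fun i => ?_⟩
  · rw [← Polynomial.natDegree_map_eq_of_injective hinj P]
    exact hsplit.natDegree_eq_card_roots.symm
  · have h := Polynomial.isRoot_of_mem_roots hz
    rw [Polynomial.IsRoot.def, Polynomial.eval_map] at h
    rw [← norm_natCast_prime]
    exact hP.zeros z h
  · have h := congrArg (fun q => Polynomial.coeff q i) hsplit.eq_prod_roots
    simp only [Polynomial.coeff_map, Polynomial.coeff_C_mul,
      Polynomial.leadingCoeff_map_of_injective hinj] at h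
    exact h

theorem IsAdmissible.norm_div_leading_lt_one {P : ℤ_[p][X]} (hP : IsAdmissible P) {i : ℕ}
    (hi : i < P.natDegree) : ‖b P i / b P P.natDegree‖ < 1 := by
  obtain ⟨s, hcard, hs, hb⟩ := hP.exists_roots
  rw [norm_div, ← PadicAlgCl.norm_extends p (b P i), hb, norm_mul, PadicAlgCl.norm_extends p,
    mul_div_cancel_left₀ _ (norm_ne_zero_iff.2 hP.leading_ne_zero)]
  exact (norm_coeff_prod_le_one s (fun z hz => (hs z hz).2) i).2 (hcard ▸ hi)

theorem IsAdmissible.norm_mul_pow_lt {P : ℤ_[p][X]} (hP : IsAdmissible P) {i : ℕ}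
    (hi : 1 ≤ i) : ‖b P i‖ * (p : ℝ)⁻¹ ^ i < ‖b P 0‖ := by
  obtain ⟨s, hcard, hs, hb⟩ := hP.exists_roots
  obtain ⟨i, rfl⟩ := Nat.exists_eq_add_of_le' hi
  rw [← PadicAlgCl.norm_extends p (b P (i + 1)), ← PadicAlgCl.norm_extends p (b P 0), hb, hb 0,
    norm_mul, norm_mul, mul_assoc]
  refine mul_lt_mul_of_pos_left ?_ ?_
  · exact norm_coeff_prod_mul_pow_lt prime_inv_pos s (fun z hz => (hs z hz).1) i
  · simpa using hP.leading_ne_zero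

theorem IsAdmissible.zero_ne_zero {P : ℤ_[p][X]} (hP : IsAdmissible P) : b P 0 ≠ 0 := by
  have := hP.norm_mul_pow_lt le_rfl
  exact norm_pos_iff.1 (lt_of_le_of_lt (by positivity) this)

theorem IsAdmissible.exists_theta {P : ℤ_[p][X]} (hP : IsAdmissible P) :
    ∃ θ : ℝ, 0 < θ ∧ θ < 1 ∧ ∀ i ∈ Finset.Icc 1 P.natDegree,
      ‖b P i / b P 0‖ * (p : ℝ)⁻¹ ^ i ≤ θ := by
  have h (i : ℕ) (hi : 1 ≤ i) : ‖b P i / b P 0‖ * (p : ℝ)⁻¹ ^ i < 1 := by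
    rw [norm_div, div_mul_eq_mul_div, div_lt_one (norm_pos_iff.2 hP.zero_ne_zero)]
    exact hP.norm_mul_pow_lt hi
  obtain hs | hs := (Finset.Icc 1 P.natDegree).eq_empty_or_nonempty
  · exact ⟨1 / 2, by norm_num, by norm_num, by simp [hs]⟩
  · obtain ⟨j, hj, hmax⟩ := Finset.exists_max_image _
      (fun i => ‖b P i / b P 0‖ * (p : ℝ)⁻¹ ^ i) hs
    -- The maximum with 1/2 serves only to keep θ positive.
    refine ⟨max (1 / 2) (‖b P j / b P 0‖ * (p : ℝ)⁻¹ ^ j), by positivity,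
      max_lt (by norm_num) (h j (Finset.mem_Icc.1 hj).1), fun i hi => ?_⟩
    exact (hmax i hi).trans (le_max_right _ _)

section Radii

theorem imageRadius_eq {r : ℝ} (hr : 0 ≤ r) :
    imageRadius p r = r * max (r ^ (p - 1)) (p : ℝ)⁻¹ := by
  rw [imageRadius, mul_max_of_nonneg _ _ hr, ← pow_succ',
    Nat.sub_add_cancel (Fact.out : p.Prime).one_le]

theorem imageRadius_le {r : ℝ} (hr : 0 ≤ r) (hr1 : r ≤ 1) : imageRadius p r ≤ r := by
  rw [imageRadius_eq hr]
  exact mul_le_of_le_one_right hr (max_le (pow_le_one₀ hr hr1) prime_inv_lt_one.le)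

theorem iterate_imageRadius_mem {r : ℝ} (h0 : 0 < r) (h1 : r < 1) (t : ℕ) :
    0 < (imageRadius p)^[t] r ∧ (imageRadius p)^[t] r ≤ r := by
  induction t with
  | zero => exact ⟨h0, le_rfl⟩
  | succ t ih =>
    rw [Function.iterate_succ_apply']
    exact ⟨imageRadius_pos ih.1, (imageRadius_le ih.1.le (ih.2.trans h1.le)).trans ih.2⟩

/-- A step multiplies the radius ρ by max(ρ^{p-1}, 1/p). Once ρ^{p-1} ≤ 1/p this factor is 1/p, so
only finitely many steps contract more slowly. -/
theorem exists_iterate_imageRadius_le {r : ℝ} (h0 : 0 < r) (h1 : r < 1) :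
    ∃ C : ℝ, 0 < C ∧ ∀ t, (imageRadius p)^[t] r ≤ C * (p : ℝ)⁻¹ ^ t := by
  have hp1 : p - 1 ≠ 0 := Nat.sub_ne_zero_of_lt (Fact.out : p.Prime).one_lt
  have hpp := prime_inv_pos (p := p)
  have hmem := iterate_imageRadius_mem (p := p) h0 h1
  set q := max (r ^ (p - 1)) (p : ℝ)⁻¹ with hq
  have hq1 : q < 1 := max_lt (pow_lt_one₀ h0.le h1 hp1) prime_inv_lt_one
  have hq0 : 0 ≤ q := hpp.le.trans (le_max_right _ _)
  have hdecay (t : ℕ) : (imageRadius p)^[t] r ≤ q ^ t := by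
    induction t with
    | zero => simpa using h1.le
    | succ t ih =>
      rw [Function.iterate_succ_apply', imageRadius_eq (hmem t).1.le, pow_succ]
      refine mul_le_mul ih ?_ (hpp.le.trans (le_max_right _ _)) (by positivity)
      exact max_le_max_right _ (pow_le_pow_left₀ (hmem t).1.le (hmem t).2 _)
  obtain ⟨t₀, ht₀⟩ := exists_pow_lt_of_lt_one hpp hq1
  have hstep (u : ℕ) : (imageRadius p)^[u + t₀] r ≤ (p : ℝ)⁻¹ ^ u := by
    induction u with
    | zero => simpa using (hmem t₀).2.trans h1.le
    | succ u ih =>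
      rw [Nat.succ_add, Function.iterate_succ_apply', imageRadius_eq (hmem _).1.le, pow_succ]
      refine mul_le_mul ih (max_le ?_ le_rfl) (hpp.le.trans (le_max_right _ _)) (by positivity)
      calc ((imageRadius p)^[u + t₀] r) ^ (p - 1) ≤ (imageRadius p)^[u + t₀] r :=
            pow_le_of_le_one (hmem _).1.le ((hmem _).2.trans h1.le) hp1
        _ ≤ q ^ (u + t₀) := hdecay _
        _ ≤ q ^ t₀ := pow_le_pow_of_le_one hq0 hq1.le (Nat.le_add_left _ _)
        _ ≤ _ := ht₀.le
  refine ⟨((p : ℝ)⁻¹ ^ t₀)⁻¹, by positivity, fun t => ?_⟩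
  rw [← div_eq_inv_mul, le_div_iff₀ (by positivity)]
  obtain ht | ht := le_total t₀ t
  · obtain ⟨u, rfl⟩ := Nat.exists_eq_add_of_le' ht
    rw [pow_add]
    exact mul_le_mul_of_nonneg_right (hstep u) (by positivity)
  · calc _ ≤ 1 * (p : ℝ)⁻¹ ^ t₀ :=
          mul_le_mul_of_nonneg_right ((hmem t).2.trans h1.le) (by positivity)
      _ = (p : ℝ)⁻¹ ^ t₀ := one_mul _
      _ ≤ _ := pow_le_pow_of_le_one hpp.le prime_inv_lt_one.le ht

end Radii

section Logarithm

variable {K : IntermediateField ℚ_[p] (PadicAlgCl p)}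

theorem IsFrobeniusLift.twist {f : K[X]} (hf : IsFrobeniusLift f) (σ : K ≃ₐ[ℚ_[p]] K) (m : ℤ) :
    IsFrobeniusLift (twist σ m f) where
  monic := hf.monic.map _
  natDegree := (Polynomial.natDegree_map _).trans hf.natDegree
  coeff_zero := by simp [hf.coeff_zero]
  coeff_le i h1 h2 := by
    rw [coeff_twist]
    exact (norm_algEquiv _ _).trans_le (hf.coeff_le i h1 h2)
  coeff_one := by
    rw [coeff_twist]
    exact (norm_algEquiv _ _).trans hf.coeff_one

theorem IsFrobeniusLift.boundedOn {f : K[X]} (hf : IsFrobeniusLift f) {r : ℝ} (h0 : 0 ≤ r)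
    (h1 : r ≤ 1) : BoundedOn r (imageRadius p r) (f : K⟦X⟧) := by
  intro N
  rw [Polynomial.coeff_coe]
  have hnonneg : 0 ≤ imageRadius p r := (pow_nonneg h0 p).trans (le_max_left _ _)
  rcases Nat.eq_zero_or_pos N with rfl | hN
  · simpa [hf.coeff_zero] using hnonneg
  rcases lt_trichotomy N p with hlt | heq | hlt
  · refine le_trans ?_ (le_max_right _ _)
    rw [mul_comm r]
    have := hf.coeff_le N hN hlt
    rw [norm_natCast_prime] at this
    exact mul_le_mul this (pow_le_of_le_one h0 h1 hN.ne') (by positivity) prime_inv_pos.le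
  · have hc : f.coeff N = 1 := by
      rw [heq.trans hf.natDegree.symm]
      exact hf.monic.coeff_natDegree
    rw [hc, norm_one, one_mul, heq]
    exact le_max_left _ _
  · rw [Polynomial.coeff_eq_zero_of_natDegree_lt (hf.natDegree.trans_lt hlt)]
    simpa using hnonneg

theorem lTerm_succ (σ : K ≃ₐ[ℚ_[p]] K) (P : ℤ_[p][X]) {f : K[X]} (hf : f.coeff 0 = 0) (k : ℕ) :
    lTerm σ P f (k + 1) = -jPhi σ P f (lTerm σ P f k) := by
  have h : jPhi σ P f ((-1) ^ k * (jPhi σ P f)^[k] PowerSeries.X) =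
      (-1) ^ k * jPhi σ P f ((jPhi σ P f)^[k] PowerSeries.X) := by
    rcases neg_one_pow_eq_or K⟦X⟧ k with h | h <;> rw [h]
    · rw [one_mul, one_mul]
    · rw [← jPhiLin_apply σ hf, ← jPhiLin_apply σ hf, neg_one_mul, neg_one_mul, map_neg]
  rw [lTerm, lTerm, h, Function.iterate_succ_apply', pow_succ]
  ring

theorem BoundedOn.phi_iterate {f : K[X]} (hf : IsFrobeniusLift f) (σ : K ≃ₐ[ℚ_[p]] K) {r : ℝ}
    (h0 : 0 < r) (h1 : r < 1) {g : K⟦X⟧} {C : ℝ} (i : ℕ)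
    (hg : BoundedOn ((imageRadius p)^[i] r) C g) :
    BoundedOn r C ((Lubin.phi σ f)^[i] g) := by
  induction i generalizing r with
  | zero => exact hg
  | succ i ih =>
    rw [Function.iterate_succ_apply']
    have hle : imageRadius p r ≤ r := imageRadius_le h0.le h1.le
    refine BoundedOn.phi h0.le σ hf.coeff_zero (hf.boundedOn h0.le h1.le) ?_
    exact ih (imageRadius_pos h0) (hle.trans_lt h1) hg

/-- φ_f^i carries a bound from the i-th iterated radius back to the original one. The factor p^{-i}
gained there offsets b_i/b_0 up to θ, so each application of j(φ_f) costs a factor θ. -/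
theorem exists_boundedOn_lTerm {P : ℤ_[p][X]} (hP : IsAdmissible P) {f : K[X]}
    (hf : IsFrobeniusLift f) (σ : K ≃ₐ[ℚ_[p]] K) {r : ℝ} (h0 : 0 < r) (h1 : r < 1) :
    ∃ θ C : ℝ, 0 < θ ∧ θ < 1 ∧ ∀ k, BoundedOn r (C * θ ^ k) (lTerm σ P f k) := by
  obtain ⟨θ, hθ0, hθ1, hθ⟩ := hP.exists_theta
  obtain ⟨C, hC0, hC⟩ := exists_iterate_imageRadius_le (p := p) h0 h1
  have hmem := iterate_imageRadius_mem (p := p) h0 h1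
  have hpp := prime_inv_pos (p := p)
  -- The induction on k needs the bound at every iterated radius simultaneously.
  suffices h : ∀ k t, BoundedOn ((imageRadius p)^[t] r) (C * (p : ℝ)⁻¹ ^ t * θ ^ k)
      (lTerm σ P f k) from ⟨θ, C, hθ0, hθ1, fun k => by simpa using h k 0⟩
  intro k
  induction k with
  | zero =>
    intro t
    simpa [lTerm] using (boundedOn_X (hmem t).1.le).mono (hC t)
  | succ k ih =>
    intro t
    rw [lTerm_succ σ P hf.coeff_zero]
    refine BoundedOn.neg (BoundedOn.sum (hmem t).1.le (by positivity) fun i hi => ?_)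
    have hi1 := (Finset.mem_Icc.1 hi).1
    have hb := ih (i + t)
    rw [Function.iterate_add_apply] at hb
    refine ((hb.phi_iterate hf σ (hmem t).1 ((hmem t).2.trans_lt h1)).smul _).mono ?_
    calc ‖b P i / b P 0‖ * (C * (p : ℝ)⁻¹ ^ (i + t) * θ ^ k)
        = (‖b P i / b P 0‖ * (p : ℝ)⁻¹ ^ i) * (C * (p : ℝ)⁻¹ ^ t * θ ^ k) := by ring
      _ ≤ θ * (C * (p : ℝ)⁻¹ ^ t * θ ^ k) := by gcongr; exact hθ i hi
      _ = _ := by ring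

theorem exists_norm_coeff_lTerm_le {P : ℤ_[p][X]} (hP : IsAdmissible P) {f : K[X]}
    (hf : IsFrobeniusLift f) (σ : K ≃ₐ[ℚ_[p]] K) {r : ℝ} (h0 : 0 < r) (h1 : r < 1) :
    ∃ θ C : ℝ, 0 < θ ∧ θ < 1 ∧
      ∀ k N, ‖PowerSeries.coeff N (lTerm σ P f k)‖ ≤ C / r ^ N * θ ^ k := by
  obtain ⟨θ, C, hθ0, hθ1, h⟩ := exists_boundedOn_lTerm hP hf σ h0 h1
  refine ⟨θ, C, hθ0, hθ1, fun k N => ?_⟩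
  rw [div_mul_eq_mul_div, le_div_iff₀ (by positivity)]
  exact h k N

theorem convergesOnDisc_lSeries {P : ℤ_[p][X]} (hP : IsAdmissible P) {f : K[X]}
    (hf : IsFrobeniusLift f) (σ : K ≃ₐ[ℚ_[p]] K) : ConvergesOnDisc (lSeries σ P f) := by
  intro r h0 h1
  obtain ⟨θ, C, hθ0, hθ1, h⟩ := exists_norm_coeff_lTerm_le hP hf σ h0 h1
  refine ⟨C * (1 - θ)⁻¹, fun N => ?_⟩
  rw [← le_div_iff₀ (by positivity), lSeries, PowerSeries.coeff_mk, mul_div_right_comm]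
  exact tsum_of_norm_bounded ((hasSum_geometric_of_lt_one hθ0.le hθ1).mul_left _) fun k => h k N

variable [FiniteDimensional ℚ_[p] K]

instance completeSpace_base : CompleteSpace K := FiniteDimensional.complete ℚ_[p] K

theorem summable_coeff_lTerm {P : ℤ_[p][X]} (hP : IsAdmissible P) {f : K[X]}
    (hf : IsFrobeniusLift f) (σ : K ≃ₐ[ℚ_[p]] K) (N : ℕ) :
    Summable fun k => PowerSeries.coeff N (lTerm σ P f k) := by
  obtain ⟨θ, C, hθ0, hθ1, h⟩ := exists_norm_coeff_lTerm_le hP hf σ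
    (show (0 : ℝ) < 1 / 2 by norm_num) (by norm_num)
  exact Summable.of_norm_bounded
    ((summable_geometric_of_lt_one hθ0.le hθ1).mul_left _) fun k => h k N

theorem coeffHasSum_lSeries {P : ℤ_[p][X]} (hP : IsAdmissible P) {f : K[X]}
    (hf : IsFrobeniusLift f) (σ : K ≃ₐ[ℚ_[p]] K) : CoeffHasSum (lTerm σ P f) (lSeries σ P f) := by
  intro N
  rw [lSeries, PowerSeries.coeff_mk]
  exact (summable_coeff_lTerm hP hf σ N).hasSum

/-- Applying -j(φ_f) shifts the defining series by one term, so only its first term X is left. -/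
theorem lSeries_add_jPhi {P : ℤ_[p][X]} (hP : IsAdmissible P) {f : K[X]}
    (hf : IsFrobeniusLift f) (σ : K ≃ₐ[ℚ_[p]] K) :
    lSeries σ P f + jPhi σ P f (lSeries σ P f) = PowerSeries.X := by
  ext1 N
  have hl := coeffHasSum_lSeries hP hf σ
  have hj := (hl.jPhi σ P hf.coeff_zero N).neg
  have h1 := (hasSum_nat_add_iff' 1).2 (hl N)
  simp only [lTerm_succ σ P hf.coeff_zero, map_neg, Finset.sum_range_one] at h1
  have := hj.unique h1
  rw [map_add, ← sub_neg_eq_add, this]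
  simp [lTerm]

theorem sum_smul_phi_iterate_lSeries {P : ℤ_[p][X]} (hP : IsAdmissible P) {f : K[X]}
    (hf : IsFrobeniusLift f) (σ : K ≃ₐ[ℚ_[p]] K) :
    ∑ s ∈ Finset.range (P.natDegree + 1), b P s • (phi σ f)^[s] (lSeries σ P f) =
      b P 0 • PowerSeries.X := by
  rw [← lSeries_add_jPhi hP hf σ, Finset.sum_range_succ', smul_add, add_comm]
  refine congrArg₂ _ rfl ?_
  rw [jPhi, Finset.smul_sum, Finset.range_eq_Ico, Finset.sum_Ico_add' (fun s =>
    b P s • (phi σ f)^[s] (lSeries σ P f)) 0 P.natDegree 1]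
  refine Finset.sum_congr (by ext; simp) fun i _ => ?_
  rw [smul_smul, mul_div_cancel₀ _ hP.zero_ne_zero]

end Logarithm

end Convergence

/-! ### Evaluating power series along a chain of points -/

section Evaluation

variable {p : ℕ} [Fact p.Prime] {K : IntermediateField ℚ_[p] (PadicAlgCl p)}

theorem ConvergesOnDisc.phi {f : K[X]} (hf : IsFrobeniusLift f) (σ : K ≃ₐ[ℚ_[p]] K) {g : K⟦X⟧}
    (hg : ConvergesOnDisc g) : ConvergesOnDisc (phi σ f g) := fun r h0 h1 =>
  (hg (imageRadius p r) (imageRadius_pos h0)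
    ((imageRadius_le h0.le h1.le).trans_lt h1)).imp fun _ hC =>
      BoundedOn.phi h0.le σ hf.coeff_zero (hf.boundedOn h0.le h1.le) hC

theorem ConvergesOnDisc.phi_iterate {f : K[X]} (hf : IsFrobeniusLift f) (σ : K ≃ₐ[ℚ_[p]] K)
    {g : K⟦X⟧} (hg : ConvergesOnDisc g) (i : ℕ) : ConvergesOnDisc ((Lubin.phi σ f)^[i] g) := by
  induction i with
  | zero => exact hg
  | succ i ih => simpa only [Function.iterate_succ_apply'] using ih.phi hf σ

theorem convergesOnDisc_phiL {P : ℤ_[p][X]} (hP : IsAdmissible P) {f : K[X]}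
    (hf : IsFrobeniusLift f) (σ : K ≃ₐ[ℚ_[p]] K) (m : ℤ) (i : ℕ) :
    ConvergesOnDisc (phiL σ P f m i) :=
  ((convergesOnDisc_lSeries hP hf σ).twistSeries σ m).phi_iterate (hf.twist σ m) σ i

theorem twistSeries_phiL (σ : K ≃ₐ[ℚ_[p]] K) (P : ℤ_[p][X]) {f : K[X]} (hf : f.coeff 0 = 0)
    (m a : ℤ) (i : ℕ) : twistSeries σ a (phiL σ P f m i) = phiL σ P f (m + a) i := by
  rw [phiL, twistSeries_phi_iterate σ a (by simp [hf]), twist_twist, twistSeries_twistSeries,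
    add_comm a, phiL]

/-- Twist the functional equation of l by σ^m and apply φ^i, which is ℚ_p-linear and commutes with
φ^s. -/
theorem sum_smul_phi_iterate_phiL {P : ℤ_[p][X]} (hP : IsAdmissible P) {f : K[X]}
    (hf : IsFrobeniusLift f) [FiniteDimensional ℚ_[p] K] (σ : K ≃ₐ[ℚ_[p]] K) (m : ℤ) (i : ℕ) :
    ∑ s ∈ Finset.range (P.natDegree + 1),
      b P s • (phi σ (twist σ m f))^[s] (phiL σ P f m i) =
      b P 0 • (phi σ (twist σ m f))^[i] PowerSeries.X := by
  have h := congrArg (twistSeries σ m) (sum_smul_phi_iterate_lSeries hP hf σ)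
  have hsmul (c : ℚ_[p]) (g : K⟦X⟧) : twistSeries σ m (c • g) = c • twistSeries σ m g := by
    ext1 N
    exact algEquiv_smul _ _ _
  have hX : twistSeries σ m PowerSeries.X = PowerSeries.X := PowerSeries.map_X _
  have hsum : twistSeries σ m (∑ s ∈ Finset.range (P.natDegree + 1),
      b P s • (phi σ f)^[s] (lSeries σ P f)) = ∑ s ∈ Finset.range (P.natDegree + 1),
      twistSeries σ m (b P s • (phi σ f)^[s] (lSeries σ P f)) :=
    map_sum (PowerSeries.map _) _ _
  rw [hsum, hsmul, hX] at h
  simp only [hsmul, twistSeries_phi_iterate σ m hf.coeff_zero] at h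
  have h0 := (hf.twist σ m).coeff_zero
  have h' := congrArg (phiLin σ h0 ^ i) h
  rw [map_sum, map_smul, phiLin_pow_apply] at h'
  rw [← h']
  refine Finset.sum_congr rfl fun s _ => ?_
  rw [map_smul, phiLin_pow_apply, phiL, ← Function.iterate_add_apply, ← Function.iterate_add_apply,
    add_comm]

variable {E : IntermediateField K (PadicAlgCl p)}

theorem norm_substTerm (g : K⟦X⟧) (x : E) (N : ℕ) :
    ‖substTerm g x N‖ = ‖PowerSeries.coeff N g‖ * ‖x‖ ^ N := by
  rw [substTerm, norm_mul, norm_pow]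
  rfl

theorem exists_norm_substTerm_le {g : K⟦X⟧} (hg : ConvergesOnDisc g) {x : E} (hx : ‖x‖ < 1) :
    ∃ C q : ℝ, 0 ≤ q ∧ q < 1 ∧ ∀ N, ‖substTerm g x N‖ ≤ C * q ^ N := by
  obtain ⟨r, hr, h1⟩ := exists_between hx
  have h0 := (norm_nonneg x).trans_lt hr
  obtain ⟨C, hC⟩ := hg r h0 h1
  refine ⟨C, ‖x‖ / r, by positivity, (div_lt_one h0).2 hr, fun N => ?_⟩
  have h := hC N
  rw [← le_div_iff₀ (by positivity)] at h
  rw [norm_substTerm, div_pow, mul_div_left_comm, mul_comm]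
  gcongr

variable [CompleteSpace E]

theorem summable_substTerm {g : K⟦X⟧} (hg : ConvergesOnDisc g) {x : E} (hx : ‖x‖ < 1) :
    Summable (substTerm g x) := by
  obtain ⟨C, q, h0, h1, h⟩ := exists_norm_substTerm_le hg hx
  exact Summable.of_norm_bounded ((summable_geometric_of_lt_one h0 h1).mul_left C) h

omit [CompleteSpace E] in
theorem hasSum_substTerm_coe (h : K[X]) (x : E) :
    HasSum (substTerm (h : K⟦X⟧) x) (Polynomial.aeval x h) := by
  rw [Polynomial.aeval_eq_sum_range]
  simp only [Algebra.smul_def]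
  have := hasSum_sum_of_ne_finset_zero (L := .unconditional ℕ) (f := substTerm (h : K⟦X⟧) x)
    (s := Finset.range (h.natDegree + 1)) fun N hN => by
      rw [substTerm, Polynomial.coeff_coe, Polynomial.coeff_eq_zero_of_natDegree_lt
        (by simpa using hN), map_zero, zero_mul]
  simpa only [substTerm, Polynomial.coeff_coe] using this

/-- Both sides are iterated sums of one absolutely convergent double series, taken in the two
orders. -/
theorem tsum_substTerm_phi {f : K[X]} (hf : IsFrobeniusLift f) (σ : K ≃ₐ[ℚ_[p]] K) {g : K⟦X⟧}
    (hg : ConvergesOnDisc g) {x : E} (hx : ‖x‖ < 1) :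
    ∑' N, substTerm (phi σ f g) x N =
      ∑' N, substTerm (twistSeries σ 1 g) (Polynomial.aeval x f) N := by
  set F : ℕ × ℕ → E := fun v => algebraMap K E (σ (PowerSeries.coeff v.1 g)) *
    substTerm ((f : K⟦X⟧) ^ v.1) x v.2 with hF
  have hFs : Summable F := by
    obtain ⟨r, hr, h1⟩ := exists_between hx
    have h0 := (norm_nonneg x).trans_lt hr
    have hi0 := imageRadius_pos (p := p) h0
    -- With ‖x‖ < r < 1 and `imageRadius p r` < s < 1, the double series is dominated by a product
    -- of geometric series with ratios `imageRadius p r / s` and ‖x‖ / r.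
    obtain ⟨s, his, hs1⟩ := exists_between ((imageRadius_le (p := p) h0.le h1.le).trans_lt h1)
    have hs0 := hi0.trans his
    obtain ⟨C, hC⟩ := hg s hs0 hs1
    have hsum := ((summable_geometric_of_lt_one (div_nonneg hi0.le hs0.le)
      ((div_lt_one hs0).2 his)).mul_of_nonneg (summable_geometric_of_lt_one
      (div_nonneg (norm_nonneg x) h0.le) ((div_lt_one h0).2 hr)) (fun _ => by positivity)
      (fun _ => by positivity)).mul_left C
    refine Summable.of_norm_bounded hsum fun v => ?_
    have h2 := hC v.1
    have h3 := (hf.boundedOn h0.le h1.le).pow h0.le v.1 v.2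
    rw [← le_div_iff₀ (by positivity)] at h2 h3
    rw [hF, norm_mul, norm_substTerm]
    have h4 : ‖algebraMap K E (σ (PowerSeries.coeff v.1 g))‖ = ‖PowerSeries.coeff v.1 g‖ :=
      norm_algEquiv σ _
    rw [h4]
    have hCs : 0 ≤ C / s ^ v.1 := div_nonneg hC.nonneg (by positivity)
    calc _ ≤ (C / s ^ v.1) * (imageRadius p r ^ v.1 / r ^ v.2 * ‖x‖ ^ v.2) := by gcongr
      _ = _ := by rw [div_pow, div_pow]; ring
  have hrow (j : ℕ) : HasSum (fun N => F (j, N))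
      (substTerm (twistSeries σ 1 g) (Polynomial.aeval x f) j) := by
    have h := (hasSum_substTerm_coe (f ^ j) x).mul_left
      (algebraMap K E (σ (PowerSeries.coeff j g)))
    rw [map_pow, Polynomial.coe_pow] at h
    have h' : substTerm (twistSeries σ 1 g) (Polynomial.aeval x f) j =
        algebraMap K E (σ (PowerSeries.coeff j g)) * Polynomial.aeval x f ^ j := by
      simp [substTerm]
    rw [h']
    exact h
  have hcol (N : ℕ) : HasSum (fun j => F (j, N)) (substTerm (phi σ f g) x N) := by
    have h := hasSum_sum_of_ne_finset_zero (L := .unconditional ℕ) (f := fun j => F (j, N))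
      (s := Finset.range (N + 1)) fun j hj => by
        rw [hF]
        simp only [substTerm]
        rw [coeff_pow_eq_zero hf.coeff_zero (by simpa using hj), map_zero, zero_mul, mul_zero]
    convert h using 1
    rw [substTerm, coeff_phi σ hf.coeff_zero, map_sum, Finset.sum_mul]
    refine Finset.sum_congr rfl fun j _ => ?_
    rw [hF, map_mul, mul_assoc]
    rfl
  have h1 := hFs.hasSum.prod_fiberwise hrow
  have h2 := ((Equiv.prodComm ℕ ℕ).hasSum_iff.2 hFs.hasSum).prod_fiberwise hcol
  rw [h1.tsum_eq, h2.tsum_eq]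

/-- Removing the outer φ replaces y_0 by y_1 and twists everything inside by σ, so the induction
runs over all m, g and y. -/
theorem tsum_substTerm_phi_iterate {f : K[X]} (hf : IsFrobeniusLift f) (σ : K ≃ₐ[ℚ_[p]] K)
    {g : K⟦X⟧} (hg : ConvergesOnDisc g) (m : ℤ) (s : ℕ) {y : ℕ → E} (hy : ∀ j, ‖y j‖ < 1)
    (hyf : ∀ j < s, Polynomial.aeval (y j) (twist σ (m + j) f) = y (j + 1)) :
    ∑' N, substTerm ((phi σ (twist σ m f))^[s] g) (y 0) N =
      ∑' N, substTerm (twistSeries σ s g) (y s) N := by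
  induction s generalizing m y g with
  | zero => rw [Function.iterate_zero_apply, Nat.cast_zero, twistSeries_zero]
  | succ s ih =>
    have hfm := hf.twist σ m
    rw [Function.iterate_succ_apply', tsum_substTerm_phi hfm σ (hg.phi_iterate hfm σ s) (hy 0),
      twistSeries_phi_iterate σ 1 hfm.coeff_zero, twist_twist]
    have h0 := hyf 0 s.succ_pos
    rw [Nat.cast_zero, add_zero] at h0
    rw [h0, add_comm 1 m, ih (hg.twistSeries σ 1) (m + 1) (y := fun j => y (j + 1))
      (fun j => hy _) (fun j hj => ?_), twistSeries_twistSeries, Nat.cast_succ]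
    rw [← hyf (j + 1) (by omega)]
    push_cast
    ring_nf

theorem sum_smul_tsum_phiL {P : ℤ_[p][X]} (hP : IsAdmissible P) {f : K[X]}
    (hf : IsFrobeniusLift f) [FiniteDimensional ℚ_[p] K] (σ : K ≃ₐ[ℚ_[p]] K) (m : ℤ) {i : ℕ}
    (hi : i ≤ P.natDegree) {y : ℕ → E} (hy : ∀ j, ‖y j‖ < 1)
    (hyf : ∀ j < P.natDegree, Polynomial.aeval (y j) (twist σ (m + j) f) = y (j + 1)) :
    ∑ s ∈ Finset.range (P.natDegree + 1),
      b P s • ∑' N, substTerm (phiL σ P f (m + s) i) (y s) N = b P 0 • y i := by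
  have hfm := hf.twist σ m
  have hsmul (c : ℚ_[p]) (g : K⟦X⟧) (x : E) (N : ℕ) :
      substTerm (c • g) x N = c • substTerm g x N := by
    rw [substTerm, coeff_smul_padic, substTerm, Algebra.smul_def, map_mul,
      ← IsScalarTower.algebraMap_apply, mul_assoc, Algebra.smul_def]
  have hXconv : ConvergesOnDisc (PowerSeries.X : K⟦X⟧) := fun r h0 _ => ⟨r, boundedOn_X h0.le⟩
  have hX : ∑' N, substTerm ((phi σ (twist σ m f))^[i] PowerSeries.X) (y 0) N = y i := by
    rw [tsum_substTerm_phi_iterate hf σ hXconv m i hy fun j hj => hyf j (hj.trans_le hi)]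
    have h := hasSum_substTerm_coe Polynomial.X (y i)
    rw [Polynomial.coe_X, Polynomial.aeval_X] at h
    rw [twistSeries, PowerSeries.map_X]
    exact h.tsum_eq
  have key (s : ℕ) (hs : s ≤ P.natDegree) :
      HasSum (substTerm ((phi σ (twist σ m f))^[s] (phiL σ P f m i)) (y 0))
        (∑' N, substTerm (phiL σ P f (m + s) i) (y s) N) := by
    have hc := convergesOnDisc_phiL hP hf σ m i
    rw [← twistSeries_phiL σ P hf.coeff_zero, ← tsum_substTerm_phi_iterate hf σ hc m s hy
      fun j hj => hyf j (hj.trans_le hs)]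
    exact (summable_substTerm (hc.phi_iterate hfm σ s) (hy 0)).hasSum
  have hsum := hasSum_sum (s := Finset.range (P.natDegree + 1)) fun s hs =>
    (key s (Nat.lt_succ_iff.1 (Finset.mem_range.1 hs))).const_smul (b P s)
  have htot : HasSum (substTerm (∑ s ∈ Finset.range (P.natDegree + 1),
      b P s • (phi σ (twist σ m f))^[s] (phiL σ P f m i)) (y 0)) (b P 0 • y i) := by
    rw [sum_smul_phi_iterate_phiL hP hf σ m i, ← hX]
    have h := (summable_substTerm (hXconv.phi_iterate hfm σ i) (hy 0)).hasSum.const_smul (b P 0)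
    exact h.congr_fun fun N => hsmul _ _ _ N
  refine HasSum.unique (hsum.congr_fun fun N => ?_) htot
  rw [substTerm, map_sum, map_sum, Finset.sum_mul]
  exact Finset.sum_congr rfl fun s _ => (hsmul _ _ _ N)

end Evaluation

/-! ### The operator j(F)⁻¹ and the constant ε -/

section Epsilon

variable {p : ℕ} [Fact p.Prime] {K : IntermediateField ℚ_[p] (PadicAlgCl p)}

theorem IsAdmissible.exists_eta {P : ℤ_[p][X]} (hP : IsAdmissible P) :
    ∃ η : ℝ, 0 < η ∧ η < 1 ∧ ∀ i < P.natDegree, ‖b P i / b P P.natDegree‖ ≤ η := by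
  obtain hs | hs := (Finset.range P.natDegree).eq_empty_or_nonempty
  · exact ⟨1 / 2, by norm_num, by norm_num, fun i hi => by simp_all⟩
  · obtain ⟨j, hj, hmax⟩ := Finset.exists_max_image _ (fun i => ‖b P i / b P P.natDegree‖) hs
    refine ⟨max (1 / 2) ‖b P j / b P P.natDegree‖, by positivity,
      max_lt (by norm_num) (hP.norm_div_leading_lt_one (Finset.mem_range.1 hj)), fun i hi => ?_⟩
    exact (hmax i (Finset.mem_range.2 hi)).trans (le_max_right _ _)

theorem algEquiv_uOp (σ : K ≃ₐ[ℚ_[p]] K) (P : ℤ_[p][X]) (m : ℤ) (x : K) :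
    (σ ^ m : K ≃ₐ[ℚ_[p]] K) (uOp σ P x) = uOp σ P ((σ ^ m : K ≃ₐ[ℚ_[p]] K) x) := by
  simp only [uOp, map_sum, algEquiv_smul, ← zpow_add_apply]
  exact Finset.sum_congr rfl fun i _ => by rw [add_comm]

theorem hasSum_uOp (σ : K ≃ₐ[ℚ_[p]] K) (P : ℤ_[p][X]) {G : ℕ → K} {x : K} (h : HasSum G x) :
    HasSum (fun k => uOp σ P (G k)) (uOp σ P x) :=
  hasSum_sum fun _ _ => (h.map (σ ^ _ : K ≃ₐ[ℚ_[p]] K) (continuous_algEquiv _)).const_smul _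

theorem uOp_neg (σ : K ≃ₐ[ℚ_[p]] K) (P : ℤ_[p][X]) (x : K) : uOp σ P (-x) = -uOp σ P x := by
  simp [uOp]

theorem uOp_neg_one_pow_mul (σ : K ≃ₐ[ℚ_[p]] K) (P : ℤ_[p][X]) (k : ℕ) (x : K) :
    uOp σ P ((-1) ^ k * x) = (-1) ^ k * uOp σ P x := by
  rcases neg_one_pow_eq_or K k with h | h <;> simp [h, uOp_neg]

theorem geomTerm_succ (σ : K ≃ₐ[ℚ_[p]] K) (P : ℤ_[p][X]) (x : K) (k : ℕ) :
    geomTerm σ P x (k + 1) = -uOp σ P (geomTerm σ P x k) := by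
  rw [geomTerm, geomTerm, uOp_neg_one_pow_mul, Function.iterate_succ_apply', pow_succ]
  ring

theorem norm_uOp_le {η : ℝ} (hη : 0 ≤ η) {P : ℤ_[p][X]}
    (h : ∀ i < P.natDegree, ‖b P i / b P P.natDegree‖ ≤ η) (σ : K ≃ₐ[ℚ_[p]] K) (x : K) :
    ‖uOp σ P x‖ ≤ η * ‖x‖ := by
  refine IsUltrametricDist.norm_sum_le_of_forall_le_of_nonneg (by positivity) fun i hi => ?_
  rw [Finset.mem_Ico] at hi
  rw [norm_smul_padic, norm_algEquiv]
  exact mul_le_mul_of_nonneg_right (h _ (by omega)) (norm_nonneg _)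

theorem norm_geomTerm_le {η : ℝ} (hη : 0 ≤ η) {P : ℤ_[p][X]}
    (h : ∀ i < P.natDegree, ‖b P i / b P P.natDegree‖ ≤ η) (σ : K ≃ₐ[ℚ_[p]] K) (x : K) (k : ℕ) :
    ‖geomTerm σ P x k‖ ≤ ‖x‖ * η ^ k := by
  induction k with
  | zero => simp [geomTerm]
  | succ k ih =>
    rw [geomTerm_succ, norm_neg]
    calc _ ≤ η * ‖geomTerm σ P x k‖ := norm_uOp_le hη h σ _
      _ ≤ η * (‖x‖ * η ^ k) := by gcongr
      _ = _ := by ring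

/-- The factor b_0/b_d has norm at most η, and by the ultrametric inequality the geometric series
does not increase the norm. -/
theorem norm_jInv_le {η : ℝ} (hη : 0 ≤ η) (hη1 : η ≤ 1) {P : ℤ_[p][X]} (hd : 0 < P.natDegree)
    (h : ∀ i < P.natDegree, ‖b P i / b P P.natDegree‖ ≤ η) (σ : K ≃ₐ[ℚ_[p]] K) (x : K) :
    ‖jInv σ P x‖ ≤ η * ‖x‖ := by
  rw [jInv, norm_smul_padic, norm_algEquiv]
  refine mul_le_mul (h 0 hd) ?_ (norm_nonneg _) hη
  refine IsUltrametricDist.norm_tsum_le_of_forall_le fun k => ?_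
  exact (norm_geomTerm_le hη h σ x k).trans
    (mul_le_of_le_one_right (norm_nonneg _) (pow_le_one₀ hη hη1))

variable [FiniteDimensional ℚ_[p] K]

theorem summable_geomTerm {P : ℤ_[p][X]} (hP : IsAdmissible P) (σ : K ≃ₐ[ℚ_[p]] K) (x : K) :
    Summable (geomTerm σ P x) := by
  obtain ⟨η, h0, h1, h⟩ := hP.exists_eta
  exact Summable.of_norm_bounded ((summable_geometric_of_lt_one h0.le h1).mul_left ‖x‖)
    (norm_geomTerm_le h0.le h σ x)

theorem summable_epsTerm {P : ℤ_[p][X]} (hP : IsAdmissible P) (hd : 0 < P.natDegree)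
    (σ : K ≃ₐ[ℚ_[p]] K) (f : K[X]) (m : ℤ) : Summable (epsTerm σ P f m) := by
  obtain ⟨η, h0, h1, h⟩ := hP.exists_eta
  have hit (x : K) (k : ℕ) : ‖(jInv σ P)^[k] x‖ ≤ ‖x‖ * η ^ k := by
    induction k with
    | zero => simp
    | succ k ih =>
      rw [Function.iterate_succ_apply']
      calc _ ≤ η * ‖(jInv σ P)^[k] x‖ := norm_jInv_le h0.le h1.le hd h σ _
        _ ≤ η * (‖x‖ * η ^ k) := by gcongr
        _ = _ := by ring
  refine Summable.of_norm_bounded (((summable_nat_add_iff 1).2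
    (summable_geometric_of_lt_one h0.le h1)).mul_left
      ‖-((σ ^ m : K ≃ₐ[ℚ_[p]] K) (f.coeff (p - 1)) / (p : K))‖) fun k => ?_
  rw [epsTerm, norm_mul, norm_pow, norm_neg, norm_one, one_pow, one_mul]
  exact hit _ _

theorem algEquiv_jInv {P : ℤ_[p][X]} (hP : IsAdmissible P) (σ : K ≃ₐ[ℚ_[p]] K) (m : ℤ) (x : K) :
    (σ ^ m : K ≃ₐ[ℚ_[p]] K) (jInv σ P x) = jInv σ P ((σ ^ m : K ≃ₐ[ℚ_[p]] K) x) := by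
  have hterm (k : ℕ) : (σ ^ m : K ≃ₐ[ℚ_[p]] K) (geomTerm σ P x k) =
      geomTerm σ P ((σ ^ m : K ≃ₐ[ℚ_[p]] K) x) k := by
    induction k with
    | zero => simp [geomTerm]
    | succ k ih => rw [geomTerm_succ, geomTerm_succ, map_neg, algEquiv_uOp, ih]
  rw [jInv, jInv, algEquiv_smul, ← zpow_add_apply, add_comm, zpow_add_apply]
  congr 2
  have := ((summable_geomTerm hP σ x).hasSum.map (σ ^ m : K ≃ₐ[ℚ_[p]] K)
    (continuous_algEquiv _)).tsum_eq
  rw [← this]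
  exact tsum_congr hterm

theorem eps_add {P : ℤ_[p][X]} (hP : IsAdmissible P) (hd : 0 < P.natDegree)
    (σ : K ≃ₐ[ℚ_[p]] K) (f : K[X]) (m a : ℤ) :
    eps σ P f (m + a) = (σ ^ a : K ≃ₐ[ℚ_[p]] K) (eps σ P f m) := by
  have hit (k : ℕ) (x : K) : (σ ^ a : K ≃ₐ[ℚ_[p]] K) ((jInv σ P)^[k] x) =
      (jInv σ P)^[k] ((σ ^ a : K ≃ₐ[ℚ_[p]] K) x) := by
    induction k with
    | zero => rfl
    | succ k ih =>
      rw [Function.iterate_succ_apply', Function.iterate_succ_apply', algEquiv_jInv hP, ih]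
  have := ((summable_epsTerm hP hd σ f m).hasSum.map (σ ^ a : K ≃ₐ[ℚ_[p]] K)
    (continuous_algEquiv _)).tsum_eq
  rw [eps, eps, ← this]
  refine tsum_congr fun k => ?_
  rw [Function.comp_apply, epsTerm, epsTerm, map_mul, hit, map_pow, map_neg, map_neg, map_one,
    map_div₀, map_natCast, ← zpow_add_apply, add_comm a]

theorem tsum_geomTerm_add_uOp {P : ℤ_[p][X]} (hP : IsAdmissible P) (σ : K ≃ₐ[ℚ_[p]] K) (x : K) :
    ∑' k, geomTerm σ P x k + uOp σ P (∑' k, geomTerm σ P x k) = x := by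
  have hs := (summable_geomTerm hP σ x).hasSum
  have h1 := (hasSum_nat_add_iff' 1).2 hs
  simp only [geomTerm_succ, Finset.sum_range_one] at h1
  have := (hasSum_uOp σ P hs).neg.unique h1
  rw [← sub_neg_eq_add, this]
  simp [geomTerm]

/-- This is j(F) j(F)⁻¹ = 1 multiplied by b_0. -/
theorem sum_smul_algEquiv_jInv {P : ℤ_[p][X]} (hP : IsAdmissible P) (hd : 0 < P.natDegree)
    (σ : K ≃ₐ[ℚ_[p]] K) (x : K) :
    ∑ s ∈ Finset.range P.natDegree,
      b P (s + 1) • (σ ^ ((s + 1 : ℕ) : ℤ) : K ≃ₐ[ℚ_[p]] K) (jInv σ P x) = b P 0 • x := by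
  set y := ∑' k, geomTerm σ P x k with hy
  have hx : y + uOp σ P y = x := tsum_geomTerm_add_uOp hP σ x
  have hl := hP.leading_ne_zero
  have hterm (s : ℕ) : b P (s + 1) • (σ ^ ((s + 1 : ℕ) : ℤ) : K ≃ₐ[ℚ_[p]] K) (jInv σ P x) =
      b P 0 • ((b P (s + 1) / b P P.natDegree) •
        (σ ^ (((s + 1 : ℕ) : ℤ) - P.natDegree) : K ≃ₐ[ℚ_[p]] K) y) := by
    rw [jInv, algEquiv_smul, ← zpow_add_apply, ← sub_eq_add_neg, smul_smul, smul_smul]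
    congr 1
    ring
  simp only [hterm]
  rw [← Finset.smul_sum]
  congr 1
  rw [← hx]
  -- With d = e + 1, the term s = e is y itself, and the remaining terms in reverse order are those
  -- of `uOp`.
  obtain ⟨e, he⟩ := Nat.exists_eq_add_of_le' hd
  rw [uOp, he, Finset.sum_range_succ, add_comm, ← Finset.sum_range_reflect]
  refine congrArg₂ _ ?_ ?_
  · rw [he] at hl
    rw [div_self hl, one_smul, sub_self, zpow_zero]
    rfl
  · rw [Finset.sum_Ico_eq_sum_range]
    refine Finset.sum_congr (by simp) fun j hj => ?_
    have hj := Finset.mem_range.1 hj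
    congr 2
    · congr 2
      omega
    · congr 2
      omega

/-- Put J = j(F)⁻¹. Then (1 + J⁻¹)(-J + J² - ⋯) = -1, and the two minus signs cancel. -/
theorem sum_smul_eps {P : ℤ_[p][X]} (hP : IsAdmissible P) (hd : 0 < P.natDegree)
    (σ : K ≃ₐ[ℚ_[p]] K) (f : K[X]) (m : ℤ) :
    ∑ s ∈ Finset.range (P.natDegree + 1), b P s • eps σ P f (m + s) =
      b P 0 • ((σ ^ m : K ≃ₐ[ℚ_[p]] K) (f.coeff (p - 1)) / (p : K)) := by
  set a : K := -((σ ^ m : K ≃ₐ[ℚ_[p]] K) (f.coeff (p - 1)) / (p : K)) with ha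
  have hs := (summable_epsTerm hP hd σ f m).hasSum
  have hJ : HasSum (fun k => ∑ s ∈ Finset.range P.natDegree, b P (s + 1) •
      (σ ^ ((s + 1 : ℕ) : ℤ) : K ≃ₐ[ℚ_[p]] K) (epsTerm σ P f m k))
      (∑ s ∈ Finset.range P.natDegree, b P (s + 1) • eps σ P f (m + (s + 1 : ℕ))) :=
    hasSum_sum fun s _ => by
      rw [eps_add hP hd]
      exact (hs.map (σ ^ ((s + 1 : ℕ) : ℤ) : K ≃ₐ[ℚ_[p]] K) (continuous_algEquiv _)).const_smul _
  have hterm (k : ℕ) : ∑ s ∈ Finset.range P.natDegree, b P (s + 1) •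
      (σ ^ ((s + 1 : ℕ) : ℤ) : K ≃ₐ[ℚ_[p]] K) (epsTerm σ P f m k) =
      b P 0 • ((-1) ^ (k + 1) * (jInv σ P)^[k] a) := by
    simp only [epsTerm, map_mul, map_pow, map_neg, map_one, ← mul_smul_comm, ← Finset.mul_sum]
    rw [Function.iterate_succ_apply', ← sum_smul_algEquiv_jInv hP hd σ]
  simp only [hterm] at hJ
  -- The term k = 0 is -a, and the tail is minus the series of ε.
  have h1 : HasSum (fun k => b P 0 • ((-1) ^ (k + 1) * (jInv σ P)^[k] a))
      (b P 0 • (-a - eps σ P f m)) := by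
    refine HasSum.const_smul (b P 0) ((hasSum_nat_add_iff' 1).1 ?_)
    have h2 : (fun k => (-1) ^ (k + 1 + 1) * (jInv σ P)^[k + 1] a) = fun k => -epsTerm σ P f m k := by
      funext k
      rw [epsTerm, pow_succ]
      ring
    rw [h2]
    have h3 : -a - eps σ P f m - ∑ k ∈ Finset.range 1, (-1) ^ (k + 1) * (jInv σ P)^[k] a =
        -eps σ P f m := by
      rw [Finset.sum_range_one, Function.iterate_zero_apply]
      ring
    rw [h3]
    exact hs.neg
  rw [Finset.sum_range_succ', hJ.unique h1, Nat.cast_zero, add_zero, ← smul_add, ha]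
  congr 1
  ring

end Epsilon

/-! ### Traces between intermediate fields -/

section RelativeTrace

open IntermediateField

variable {F L : Type*} [Field F] [Field L] [Algebra F L]

/-- The trace from `B` to `A` for intermediate fields `A ≤ B`. -/
def relTrace {A B : IntermediateField F L} (h : A ≤ B) (x : B) : A :=
  Algebra.trace A (extendScalars h) ⟨x, x.2⟩

variable {A B C : IntermediateField F L}

theorem relTrace_add (h : A ≤ B) (x y : B) : relTrace h (x + y) = relTrace h x + relTrace h y :=
  map_add (Algebra.trace A (extendScalars h)) ⟨x, x.2⟩ ⟨y, y.2⟩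

theorem relTrace_zero (h : A ≤ B) : relTrace h 0 = 0 :=
  map_zero (Algebra.trace A (extendScalars h))

theorem relTrace_sum {ι : Type*} (h : A ≤ B) (s : Finset ι) (x : ι → B) :
    relTrace h (∑ i ∈ s, x i) = ∑ i ∈ s, relTrace h (x i) := by
  classical
  induction s using Finset.induction_on with
  | empty => exact relTrace_zero h
  | insert i s hi ih => rw [Finset.sum_insert hi, Finset.sum_insert hi, relTrace_add, ih]

theorem relTrace_mul (h : A ≤ B) (a : A) (x : B) :
    relTrace h (inclusion h a * x) = a * relTrace h x :=
  (Algebra.trace A (extendScalars h)).map_smul a ⟨x, x.2⟩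

theorem relTrace_inclusion (h : A ≤ B) (a : A) :
    relTrace h (inclusion h a) = Module.finrank A (extendScalars h) • a :=
  Algebra.trace_algebraMap (S := extendScalars h) a

theorem finrank_mul_finrank_extendScalars (h : A ≤ B) :
    Module.finrank F A * Module.finrank A (extendScalars h) = Module.finrank F B := by
  rw [← relfinrank_eq_finrank_of_le, finrank_bot_mul_relfinrank h]

/-- Transitivity of the trace when the middle and top fields appear in two guises, with different
base fields, identified by e and e'. -/
theorem trace_trace_ringEquiv {R S T S' T' : Type*} [Field R] [Field S] [Field T] [Field S']
    [Field T'] [Algebra R S] [Algebra R T] [Algebra S' T'] [FiniteDimensional R T]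
    (j : S →ₐ[R] T) (e : S' ≃+* S) (e' : T' ≃+* T)
    (he : ∀ s, j (e s) = e' (algebraMap S' T' s)) (x : T') :
    Algebra.trace R S (e (Algebra.trace S' T' x)) = Algebra.trace R T (e' x) := by
  let _ : Algebra S T := j.toRingHom.toAlgebra
  have : IsScalarTower R S T := IsScalarTower.of_algebraMap_eq fun r => (j.commutes r).symm
  have : FiniteDimensional S T := FiniteDimensional.right R S T
  have : FiniteDimensional R S := FiniteDimensional.left R S T
  rw [Algebra.trace_eq_of_equiv_equiv e e' (RingHom.ext he), RingEquiv.apply_symm_apply,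
    Algebra.trace_trace]

theorem relTrace_relTrace [FiniteDimensional F C] (hAB : A ≤ B) (hBC : B ≤ C) (x : C) :
    relTrace hAB (relTrace hBC x) = relTrace (hAB.trans hBC) x := by
  have : FiniteDimensional F (extendScalars (hAB.trans hBC)) :=
    inferInstanceAs (FiniteDimensional F C)
  have : FiniteDimensional A (extendScalars (hAB.trans hBC)) :=
    FiniteDimensional.right F A _
  let e : B ≃+* extendScalars hAB := RingEquiv.refl B
  let e' : extendScalars hBC ≃+* extendScalars (hAB.trans hBC) := RingEquiv.refl C
  let j : extendScalars hAB →ₐ[A] extendScalars (hAB.trans hBC) :=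
    inclusion ((extendScalars_le_extendScalars_iff hAB (hAB.trans hBC)).2 hBC)
  exact trace_trace_ringEquiv j e e' (fun _ => rfl) ⟨x, x.2⟩

theorem finrank_extendScalars_adjoin {w : L} (h : A ≤ F⟮w⟯) (hw : IsIntegral F w) :
    Module.finrank A (extendScalars h) = (minpoly A w).natDegree := by
  rw [extendScalars_adjoin h]
  exact adjoin.finrank hw.tower_top

theorem relTrace_gen {w : L} (h : A ≤ F⟮w⟯) (hw : IsIntegral F w) :
    relTrace h (AdjoinSimple.gen F w) = -(minpoly A w).nextCoeff := by
  -- Replacing the field by a variable E lets the equality with A⟮w⟯ be substituted.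
  have key (E : IntermediateField A L) (hE : E = A⟮w⟯) (hwE : w ∈ E) :
      Algebra.trace A E ⟨w, hwE⟩ = -(minpoly A w).nextCoeff := by
    subst hE
    exact trace_adjoinSimpleGen hw.tower_top
  exact key _ (extendScalars_adjoin h) _

end RelativeTrace

/-! ### Norms of the torsion points -/

section Torsion

variable {p : ℕ} [Fact p.Prime] {K : IntermediateField ℚ_[p] (PadicAlgCl p)}

theorem norm_eq_of_norm_sub_lt {k : Type*} [NormedField k] [IsUltrametricDist k] {x y : k}
    (h : ‖x - y‖ < ‖x‖) : ‖x‖ = ‖y‖ := by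
  rw [sub_eq_add_neg] at h
  simpa using IsUltrametricDist.norm_eq_of_add_norm_lt_max (h.trans_le (le_max_left ‖x‖ ‖-y‖))

theorem IsFrobeniusLift.aeval_eq {f : K[X]} (hf : IsFrobeniusLift f) (x : PadicAlgCl p) :
    Polynomial.aeval x f =
      x ^ p + (f.coeff 1 * x + ∑ i ∈ Finset.Ico 2 p, f.coeff i * x ^ i) := by
  have hp := (Fact.out : p.Prime).one_lt
  have hc : f.coeff p = 1 := by
    have := hf.monic.coeff_natDegree
    rwa [hf.natDegree] at this
  rw [Polynomial.aeval_eq_sum_range' (n := p + 1) (by rw [hf.natDegree]; omega),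
    Finset.sum_range_succ, hc, one_smul, add_comm, Finset.range_eq_Ico,
    Finset.sum_eq_sum_Ico_succ_bot (by omega), Finset.sum_eq_sum_Ico_succ_bot (by omega),
    hf.coeff_zero, zero_smul, zero_add, zero_add, pow_one]
  rfl

theorem IsFrobeniusLift.norm_tail_le {f : K[X]} (hf : IsFrobeniusLift f) {x : PadicAlgCl p}
    {D : ℝ} (h0 : 0 ≤ D) (hD : ∀ i, 2 ≤ i → i < p → ‖x‖ ^ i ≤ D) :
    ‖∑ i ∈ Finset.Ico 2 p, (f.coeff i : PadicAlgCl p) * x ^ i‖ ≤ (p : ℝ)⁻¹ * D := by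
  have hpp := prime_inv_pos (p := p)
  refine IsUltrametricDist.norm_sum_le_of_forall_le_of_nonneg (by positivity) fun i hi => ?_
  rw [Finset.mem_Ico] at hi
  have := hf.coeff_le i (by omega) hi.2
  rw [norm_natCast_prime] at this
  rw [norm_mul, norm_pow]
  exact mul_le_mul this (hD i hi.1 hi.2) (by positivity) hpp.le

theorem IsFrobeniusLift.norm_aeval_sub_le {f : K[X]} (hf : IsFrobeniusLift f) {x : PadicAlgCl p}
    {D : ℝ} (hD : ∀ i, 1 ≤ i → i < p → ‖x‖ ^ i ≤ D) :
    ‖Polynomial.aeval x f - x ^ p‖ ≤ (p : ℝ)⁻¹ * D := by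
  have h1 : ‖x‖ ≤ D := by simpa using hD 1 le_rfl (Fact.out : p.Prime).one_lt
  rw [hf.aeval_eq, add_sub_cancel_left]
  refine (IsUltrametricDist.norm_add_le_max _ _).trans (max_le ?_
    (hf.norm_tail_le ((norm_nonneg _).trans h1) fun i h2 => hD i (by omega)))
  rw [norm_mul, hf.coeff_one, norm_natCast_prime]
  exact mul_le_mul_of_nonneg_left h1 prime_inv_pos.le

/-- For ‖x‖ ≥ 1 the term x^p dominates, so ‖f(x)‖ = ‖x‖^p ≥ 1. -/
theorem IsFrobeniusLift.norm_lt_one {f : K[X]} (hf : IsFrobeniusLift f) {x : PadicAlgCl p}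
    (h : ‖Polynomial.aeval x f‖ < 1) : ‖x‖ < 1 := by
  by_contra! hx
  have hp := (Fact.out : p.Prime).one_le
  have hle := hf.norm_aeval_sub_le (x := x) (D := ‖x‖ ^ (p - 1)) fun i _ hi =>
    pow_le_pow_right₀ hx (by omega)
  have hpow : 1 ≤ ‖x‖ ^ (p - 1) := one_le_pow₀ hx
  have hlt : ‖x ^ p - Polynomial.aeval x f‖ < ‖x ^ p‖ := by
    rw [norm_sub_rev, norm_pow]
    refine hle.trans_lt ?_
    calc (p : ℝ)⁻¹ * ‖x‖ ^ (p - 1) < 1 * ‖x‖ ^ (p - 1) :=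
          mul_lt_mul_of_pos_right prime_inv_lt_one (by positivity)
      _ ≤ ‖x‖ ^ p := by rw [one_mul]; exact pow_le_pow_right₀ hx (by omega)
  rw [← norm_eq_of_norm_sub_lt hlt, norm_pow] at h
  exact absurd (one_le_pow₀ hx) (not_le.2 h)

theorem IsTorsionSequence.norm_lt_one {σ : K ≃ₐ[ℚ_[p]] K} {f : K[X]} (hf : IsFrobeniusLift f)
    {π : ℕ → PadicAlgCl p} (hπ : IsTorsionSequence σ f π) (k : ℕ) : ‖π k‖ < 1 := by
  induction k with
  | zero => simp [hπ.zero]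
  | succ k ih =>
    refine (hf.twist σ (-((k + 1 : ℕ) : ℤ))).norm_lt_one (x := π (k + 1)) ?_
    rw [hπ.eval (k + 1) k.succ_pos]
    exact ih

/-- At level 1 the linear term balances X^p. Above it, ‖π_{k+1}‖ ≥ 1/p exceeds the terms of degree
below p, so ‖π_{k+1}‖ = ‖π_{k+2}‖^p. -/
theorem IsTorsionSequence.norm_pow {σ : K ≃ₐ[ℚ_[p]] K} {f : K[X]} (hf : IsFrobeniusLift f)
    {π : ℕ → PadicAlgCl p} (hπ : IsTorsionSequence σ f π) (k : ℕ) :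
    ‖π (k + 1)‖ ^ ((p - 1) * p ^ k) = (p : ℝ)⁻¹ := by
  have hp := (Fact.out : p.Prime).one_lt
  have hpp := prime_inv_pos (p := p)
  induction k with
  | zero =>
    have hfm := hf.twist σ (-((1 : ℕ) : ℤ))
    have hx := hπ.norm_lt_one hf 1
    have hx0 : 0 < ‖π 1‖ := norm_pos_iff.2 (hπ.ne_zero 1 le_rfl)
    have he := hπ.eval 1 le_rfl
    rw [hfm.aeval_eq, Nat.sub_self, hπ.zero] at he
    have htail := hfm.norm_tail_le (x := π 1) (D := ‖π 1‖ ^ 2) (by positivity) fun i hi _ =>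
      pow_le_pow_of_le_one hx0.le hx.le hi
    have hα : ‖((twist σ (-((1 : ℕ) : ℤ)) f).coeff 1 : PadicAlgCl p) * π 1‖ = (p : ℝ)⁻¹ * ‖π 1‖ := by
      rw [norm_mul, hfm.coeff_one, norm_natCast_prime]
    have hlt : ‖((twist σ (-((1 : ℕ) : ℤ)) f).coeff 1 : PadicAlgCl p) * π 1 - -(π 1 ^ p)‖ <
        ‖((twist σ (-((1 : ℕ) : ℤ)) f).coeff 1 : PadicAlgCl p) * π 1‖ := by
      rw [hα, sub_neg_eq_add, ← norm_neg]
      have : -(((twist σ (-((1 : ℕ) : ℤ)) f).coeff 1 : PadicAlgCl p) * π 1 + π 1 ^ p) =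
          ∑ i ∈ Finset.Ico 2 p, ((twist σ (-((1 : ℕ) : ℤ)) f).coeff i : PadicAlgCl p) * π 1 ^ i := by
        linear_combination -he
      rw [this]
      refine htail.trans_lt (mul_lt_mul_of_pos_left ?_ hpp)
      rw [sq]
      exact mul_lt_of_lt_one_left hx0 hx
    have heq := norm_eq_of_norm_sub_lt hlt
    have hpow : ‖π 1‖ ^ p = ‖π 1‖ ^ (p - 1) * ‖π 1‖ := by
      rw [← pow_succ, Nat.sub_add_cancel hp.le]
    rw [hα, norm_neg, _root_.norm_pow, hpow] at heq
    rw [zero_add, pow_zero, mul_one]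
    exact (mul_right_cancel₀ hx0.ne' heq).symm
  | succ k ih =>
    have hfm := hf.twist σ (-((k + 1 + 1 : ℕ) : ℤ))
    have hx := hπ.norm_lt_one hf (k + 1 + 1)
    have he := hπ.eval (k + 1 + 1) (by omega)
    rw [Nat.add_sub_cancel] at he
    have hle := hfm.norm_aeval_sub_le (x := π (k + 1 + 1)) (D := ‖π (k + 1 + 1)‖) fun i hi _ =>
      pow_le_of_le_one (norm_nonneg _) hx.le (by omega)
    rw [he] at hle
    have hy : (p : ℝ)⁻¹ ≤ ‖π (k + 1)‖ := by
      rw [← ih]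
      refine pow_le_of_le_one (norm_nonneg _) (hπ.norm_lt_one hf _).le ?_
      have : 0 < (p - 1) * p ^ k := Nat.mul_pos (by omega) (pow_pos (by omega) k)
      omega
    have hlt : ‖π (k + 1) - π (k + 1 + 1) ^ p‖ < ‖π (k + 1)‖ :=
      hle.trans_lt ((mul_lt_of_lt_one_right hpp hx).trans_le hy)
    have heq := norm_eq_of_norm_sub_lt hlt
    rw [heq, _root_.norm_pow, ← pow_mul] at ih
    rw [← ih, pow_succ]
    congr 1
    ring

/-- Otherwise scaling x by a power of p would give a norm strictly between 1/p and 1. -/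
theorem IsUnramified.exists_zpow (hK : IsUnramified K) {x : K} (hx : x ≠ 0) :
    ∃ z : ℤ, ‖x‖ = (p : ℝ) ^ z := by
  have hp : (1 : ℝ) < p := Nat.one_lt_cast.2 (Fact.out : p.Prime).one_lt
  have hp0 : (0 : ℝ) < p := by linarith
  obtain ⟨z, h1, h2⟩ := exists_mem_Ioc_zpow (norm_pos_iff.2 hx) hp
  refine ⟨z + 1, le_antisymm h2 ?_⟩
  by_contra! h3
  have hpn : ‖(p : PadicAlgCl p)‖ = (p : ℝ)⁻¹ := norm_natCast_prime
  have hn : ‖((x * (p : K) ^ (z + 1) : K) : PadicAlgCl p)‖ = ‖x‖ * ((p : ℝ) ^ (z + 1))⁻¹ := by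
    have hz : ((x * (p : K) ^ (z + 1) : K) : PadicAlgCl p) = x * (p : PadicAlgCl p) ^ (z + 1) :=
      rfl
    rw [hz, norm_mul, norm_zpow, hpn, inv_zpow]
    rfl
  have h := hK (x * (p : K) ^ (z + 1)) (by
    rw [hn, ← div_eq_mul_inv, div_lt_one (by positivity)]
    exact h3)
  rw [hn, hpn, ← div_eq_mul_inv, div_le_iff₀ (by positivity), zpow_add_one₀ hp0.ne', mul_comm,
    mul_assoc, mul_inv_cancel₀ hp0.ne', mul_one] at h
  exact absurd h1 (not_lt.2 h)

/-- The term of degree i has valuation in i/e + ℤ. For i < e these classes differ, so the nonzero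
terms have distinct norms and cannot cancel. -/
theorem aeval_ne_zero_of_natDegree_lt (hK : IsUnramified K) {e : ℕ} {w : PadicAlgCl p}
    (hw : ‖w‖ ^ e = (p : ℝ)⁻¹) {q : K[X]} (hq : q ≠ 0) (hdeg : q.natDegree < e) :
    Polynomial.aeval w q ≠ 0 := by
  have hp : (1 : ℝ) < p := Nat.one_lt_cast.2 (Fact.out : p.Prime).one_lt
  have hp0 : (0 : ℝ) < p := by linarith
  have hw0 : ‖w‖ ≠ 0 := by
    intro h
    rw [h, zero_pow (by omega)] at hw
    exact prime_inv_pos.ne hw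
  have hsup : q.support.Nonempty := Polynomial.nonempty_support_iff.2 hq
  have hpair : Set.Pairwise (q.support : Set ℕ)
      fun i j => ‖(q.coeff i : PadicAlgCl p) * w ^ i‖ ≠ ‖(q.coeff j : PadicAlgCl p) * w ^ j‖ := by
    intro i hi j hj hij h
    have hi' := Polynomial.mem_support_iff.1 hi
    have hj' := Polynomial.mem_support_iff.1 hj
    obtain ⟨a, ha⟩ := hK.exists_zpow hi'
    obtain ⟨c, hc⟩ := hK.exists_zpow hj'
    have hie := (Polynomial.le_natDegree_of_mem_supp i hi).trans_lt hdeg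
    have hje := (Polynomial.le_natDegree_of_mem_supp j hj).trans_lt hdeg
    have ha' : ‖(q.coeff i : PadicAlgCl p)‖ = (p : ℝ) ^ a := ha
    have hc' : ‖(q.coeff j : PadicAlgCl p)‖ = (p : ℝ) ^ c := hc
    rw [norm_mul, norm_mul, norm_pow, norm_pow, ha', hc'] at h
    have h2 := congrArg (· ^ e) h
    simp only [mul_pow] at h2
    rw [← pow_mul, ← pow_mul, mul_comm i, mul_comm j, pow_mul, pow_mul, hw, ← zpow_natCast,
      ← zpow_natCast, ← zpow_natCast, ← zpow_natCast, ← zpow_mul, ← zpow_mul, inv_zpow', inv_zpow',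
      ← zpow_add₀ hp0.ne', ← zpow_add₀ hp0.ne'] at h2
    have h3 := zpow_right_injective₀ hp0 hp.ne' h2
    have h4 : (e : ℤ) ∣ i - j := ⟨a - c, by linear_combination -h3⟩
    have h5 := Int.eq_zero_of_abs_lt_dvd h4 (by rw [abs_lt]; omega)
    omega
  have hsum : Polynomial.aeval w q = ∑ i ∈ q.support, (q.coeff i : PadicAlgCl p) * w ^ i := by
    rw [Polynomial.aeval_def, Polynomial.eval₂_eq_sum, Polynomial.sum_def]
    rfl
  rw [hsum, ← norm_ne_zero_iff, IsUltrametricDist.norm_sum_eq_sup'_of_pairwise_ne hsup hpair]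
  obtain ⟨i, hi⟩ := hsup
  refine ((Finset.lt_sup'_iff _).2 ⟨i, hi, ?_⟩).ne'
  refine norm_pos_iff.2 (mul_ne_zero ?_ (pow_ne_zero _ (norm_ne_zero_iff.1 hw0)))
  simpa using Polynomial.mem_support_iff.1 hi

/-! ### Degrees and minimal polynomials in the torsion tower -/

section Degrees

variable {σ : K ≃ₐ[ℚ_[p]] K} {f : K[X]} {π : ℕ → PadicAlgCl p}

theorem isIntegral_padicAlgCl (x : PadicAlgCl p) : IsIntegral K x :=
  (Algebra.IsIntegral.isIntegral (R := ℚ_[p]) x).tower_top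

instance finiteDimensional_adjoin (x : PadicAlgCl p) : FiniteDimensional K K⟮x⟯ :=
  IntermediateField.adjoin.finiteDimensional (isIntegral_padicAlgCl x)

/-- The polynomial `f^{σ^{-(k+1)}} - π_k` over `K(π_k)`. -/
def torsionPoly (σ : K ≃ₐ[ℚ_[p]] K) (f : K[X]) (π : ℕ → PadicAlgCl p) (k : ℕ) : K⟮π k⟯[X] :=
  (twist σ (-((k + 1 : ℕ) : ℤ)) f).map (algebraMap K K⟮π k⟯) -
    Polynomial.C (IntermediateField.AdjoinSimple.gen K (π k))

theorem torsionPoly_monic (hf : IsFrobeniusLift f) (k : ℕ) :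
    (torsionPoly σ f π k).Monic ∧ (torsionPoly σ f π k).natDegree = p := by
  have hm := (hf.twist σ (-((k + 1 : ℕ) : ℤ))).monic.map (algebraMap K K⟮π k⟯)
  have hd : ((twist σ (-((k + 1 : ℕ) : ℤ)) f).map (algebraMap K K⟮π k⟯)).natDegree = p :=
    (Polynomial.natDegree_map _).trans (hf.twist σ _).natDegree
  refine ⟨hm.sub_of_left ?_, ?_⟩
  · refine Polynomial.degree_C_le.trans_lt ?_
    rw [← Polynomial.natDegree_pos_iff_degree_pos, hd]
    exact (Fact.out : p.Prime).pos
  · rw [torsionPoly, Polynomial.natDegree_sub_C, hd]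

theorem aeval_torsionPoly (hπ : IsTorsionSequence σ f π) (k : ℕ) :
    Polynomial.aeval (π (k + 1)) (torsionPoly σ f π k) = 0 := by
  rw [torsionPoly, map_sub, Polynomial.aeval_map_algebraMap, hπ.eval (k + 1) k.succ_pos,
    Polynomial.aeval_C, Nat.add_sub_cancel]
  exact sub_self _

theorem natDegree_minpoly_le (hf : IsFrobeniusLift f) (hπ : IsTorsionSequence σ f π) (k : ℕ) :
    (minpoly K⟮π k⟯ (π (k + 1))).natDegree ≤ p := by
  have hm := torsionPoly_monic (σ := σ) (π := π) hf k
  exact (Polynomial.natDegree_le_of_dvd (minpoly.dvd _ _ (aeval_torsionPoly hπ k))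
    hm.1.ne_zero).trans hm.2.le

/-- As π_1 is a nonzero root, it is a root of the twisted f divided by X. -/
theorem natDegree_minpoly_one_le (hf : IsFrobeniusLift f) (hπ : IsTorsionSequence σ f π) :
    (minpoly K (π 1)).natDegree ≤ p - 1 := by
  set g := twist σ (-((1 : ℕ) : ℤ)) f with hg
  have hgl : IsFrobeniusLift g := hf.twist σ _
  have hdeg : g.divX.natDegree = p - 1 := by rw [Polynomial.natDegree_divX_eq_natDegree_tsub_one, hgl.natDegree]
  have hne : g.divX ≠ 0 := by
    intro h
    rw [h, Polynomial.natDegree_zero] at hdeg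
    have := (Fact.out : p.Prime).one_lt
    omega
  have hroot : Polynomial.aeval (π 1) g.divX = 0 := by
    have h := congrArg (Polynomial.aeval (π 1)) (Polynomial.divX_mul_X_add g)
    rw [hπ.eval 1 le_rfl, Nat.sub_self, hπ.zero, hgl.coeff_zero, map_add, map_mul,
      Polynomial.aeval_X, map_zero, map_zero, add_zero] at h
    exact (mul_eq_zero.1 h).resolve_right (hπ.ne_zero 1 le_rfl)
  exact (Polynomial.natDegree_le_of_dvd (minpoly.dvd _ _ hroot) hne).trans hdeg.le

theorem le_finrank_adjoin (hK : IsUnramified K) (hf : IsFrobeniusLift f)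
    (hπ : IsTorsionSequence σ f π) (k : ℕ) :
    (p - 1) * p ^ k ≤ Module.finrank K K⟮π (k + 1)⟯ := by
  rw [IntermediateField.adjoin.finrank (isIntegral_padicAlgCl _)]
  by_contra! h
  exact aeval_ne_zero_of_natDegree_lt hK (hπ.norm_pow hf k)
    (minpoly.ne_zero (isIntegral_padicAlgCl _)) h (minpoly.aeval _ _)

theorem finrank_adjoin_le (hf : IsFrobeniusLift f) (hπ : IsTorsionSequence σ f π) (k : ℕ) :
    Module.finrank K K⟮π (k + 1)⟯ ≤ (p - 1) * p ^ k := by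
  induction k with
  | zero =>
    rw [IntermediateField.adjoin.finrank (isIntegral_padicAlgCl _), pow_zero, mul_one]
    exact natDegree_minpoly_one_le hf hπ
  | succ k ih =>
    have h : K⟮π (k + 1)⟯ ≤ K⟮π (k + 1 + 1)⟯ := hπ.adjoin_le (Nat.le_succ _)
    rw [← finrank_mul_finrank_extendScalars h, pow_succ, ← mul_assoc,
      finrank_extendScalars_adjoin h (isIntegral_padicAlgCl _)]
    exact Nat.mul_le_mul ih (natDegree_minpoly_le hf hπ (k + 1))

/-- The norm of π_{k+1} bounds the degree below; the explicit equations of the tower bound it above.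
-/
theorem finrank_adjoin (hK : IsUnramified K) (hf : IsFrobeniusLift f)
    (hπ : IsTorsionSequence σ f π) (k : ℕ) :
    Module.finrank K K⟮π (k + 1)⟯ = (p - 1) * p ^ k :=
  le_antisymm (finrank_adjoin_le hf hπ k) (le_finrank_adjoin hK hf hπ k)

theorem finrank_extendScalars (hK : IsUnramified K) (hf : IsFrobeniusLift f)
    (hπ : IsTorsionSequence σ f π) {m n : ℕ} (hm : 1 ≤ m) (hmn : m ≤ n) :
    Module.finrank K⟮π m⟯ (IntermediateField.extendScalars (hπ.adjoin_le hmn)) = p ^ (n - m) := by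
  have hp := (Fact.out : p.Prime).one_lt
  have h := finrank_mul_finrank_extendScalars (hπ.adjoin_le hmn)
  obtain ⟨k, rfl⟩ := Nat.exists_eq_add_of_le' hm
  obtain ⟨j, rfl⟩ := Nat.exists_eq_add_of_le' (hm.trans hmn)
  have hkj : k ≤ j := by omega
  rw [finrank_adjoin hK hf hπ, finrank_adjoin hK hf hπ, ← pow_mul_pow_sub p hkj,
    ← mul_assoc] at h
  rw [Nat.add_sub_add_right]
  exact Nat.eq_of_mul_eq_mul_left (Nat.mul_pos (by omega) (pow_pos (by omega) k)) h

/-- The step has degree p, so `torsionPoly` is the minimal polynomial. Subtracting π_k changes only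
the constant coefficient, not the one of degree p - 1 ≥ 1. -/
theorem relTrace_torsion (hK : IsUnramified K) (hf : IsFrobeniusLift f)
    (hπ : IsTorsionSequence σ f π) {k : ℕ} (hk : 1 ≤ k) :
    relTrace (hπ.adjoin_le k.le_succ) (IntermediateField.AdjoinSimple.gen K (π (k + 1))) =
      algebraMap K K⟮π k⟯
        (-(σ ^ (-((k + 1 : ℕ) : ℤ)) : K ≃ₐ[ℚ_[p]] K) (f.coeff (p - 1))) := by
  have hp := (Fact.out : p.Prime).one_lt
  have hm := torsionPoly_monic (σ := σ) (π := π) hf k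
  have hmin : torsionPoly σ f π k = minpoly K⟮π k⟯ (π (k + 1)) := by
    refine Polynomial.eq_of_monic_of_dvd_of_natDegree_le
      (minpoly.monic (isIntegral_padicAlgCl (K := K) _).tower_top) hm.1
      (minpoly.dvd _ _ (aeval_torsionPoly hπ k)) ?_
    have h := finrank_extendScalars hK hf hπ hk k.le_succ
    rw [finrank_extendScalars_adjoin _ (isIntegral_padicAlgCl _), Nat.succ_eq_add_one,
      Nat.add_sub_cancel_left, pow_one] at h
    rw [h, hm.2]
  rw [relTrace_gen _ (isIntegral_padicAlgCl _), map_neg, Nat.succ_eq_add_one, ← hmin,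
    Polynomial.nextCoeff_of_natDegree_pos (by omega), hm.2, torsionPoly, Polynomial.coeff_sub,
    Polynomial.coeff_C_of_ne_zero (by omega), sub_zero, Polynomial.coeff_map, coeff_twist]

end Degrees

end Torsion

/-! ### The relation before and after taking traces -/

section TraceRelation

open IntermediateField

variable {p : ℕ} [Fact p.Prime] {K : IntermediateField ℚ_[p] (PadicAlgCl p)}

instance completeSpace_adjoin [FiniteDimensional ℚ_[p] K] (x : PadicAlgCl p) :
    CompleteSpace K⟮x⟯ := by
  have : FiniteDimensional ℚ_[p] K⟮x⟯ := FiniteDimensional.trans ℚ_[p] K K⟮x⟯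
  have : ContinuousSMul ℚ_[p] K⟮x⟯ :=
    ⟨(continuous_fst.smul (continuous_subtype_val.comp continuous_snd)).subtype_mk _⟩
  exact FiniteDimensional.complete ℚ_[p] K⟮x⟯

section Inclusion

variable {A B : IntermediateField K (PadicAlgCl p)} (h : A ≤ B)

theorem relTrace_smul_padic (c : ℚ_[p]) (x : B) : relTrace h (c • x) = c • relTrace h x := by
  rw [Algebra.smul_def, Algebra.smul_def]
  exact relTrace_mul h (algebraMap ℚ_[p] A c) x

theorem inclusion_value {σ : K ≃ₐ[ℚ_[p]] K} {P : ℤ_[p][X]} {f : K[X]} {m : ℤ} {i : ℕ} {x : A}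
    (hx : Summable (substTerm (phiL σ P f m i) x)) :
    inclusion h (value σ P f m i x) = value σ P f m i (inclusion h x) := by
  have hc : Continuous (inclusion h) := continuous_inclusion h
  have hs := (hx.hasSum.map (inclusion h) hc).tsum_eq
  rw [value, value, map_add, AlgHom.commutes, ← hs]
  rfl

end Inclusion

variable {σ : K ≃ₐ[ℚ_[p]] K} {f : K[X]} {π : ℕ → PadicAlgCl p}

theorem relTrace_inclusion_torsion (hK : IsUnramified K) (hf : IsFrobeniusLift f)
    (hπ : IsTorsionSequence σ f π) {l m n : ℕ} (hl : 1 ≤ l) (hlm : l ≤ m) (hmn : m ≤ n)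
    (x : K⟮π m⟯) :
    relTrace (hπ.adjoin_le (hlm.trans hmn)) (inclusion (hπ.adjoin_le hmn) x) =
      (p : ℚ_[p]) ^ (n - m) • relTrace (hπ.adjoin_le hlm) x := by
  rw [← relTrace_relTrace (hπ.adjoin_le hlm) (hπ.adjoin_le hmn), relTrace_inclusion,
    finrank_extendScalars hK hf hπ (hl.trans hlm) hmn, ← relTrace_smul_padic]
  congr 1
  rw [nsmul_eq_mul, Algebra.smul_def]
  simp

theorem relTrace_algebraMap (hK : IsUnramified K) (hf : IsFrobeniusLift f)
    (hπ : IsTorsionSequence σ f π) {m n : ℕ} (hm : 1 ≤ m) (hmn : m ≤ n) (a : K) :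
    relTrace (hπ.adjoin_le hmn) (algebraMap K K⟮π n⟯ a) =
      (p : ℚ_[p]) ^ (n - m) • algebraMap K K⟮π m⟯ a := by
  have h := relTrace_inclusion (hπ.adjoin_le hmn) (algebraMap K K⟮π m⟯ a)
  rw [AlgHom.commutes, finrank_extendScalars hK hf hπ hm hmn] at h
  rw [h, nsmul_eq_mul, Algebra.smul_def]
  simp

theorem relTrace_gen_torsion (hK : IsUnramified K) (hf : IsFrobeniusLift f)
    (hπ : IsTorsionSequence σ f π) {m n : ℕ} (hm : 1 ≤ m) (hmn : m < n) :
    relTrace (hπ.adjoin_le hmn.le) (AdjoinSimple.gen K (π n)) =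
      (p : ℚ_[p]) ^ (n - 1 - m) • algebraMap K K⟮π m⟯
        (-(σ ^ (-(n : ℤ)) : K ≃ₐ[ℚ_[p]] K) (f.coeff (p - 1))) := by
  obtain ⟨k, rfl⟩ := Nat.exists_eq_add_of_le' (Nat.one_le_of_lt hmn)
  rw [← relTrace_relTrace (hπ.adjoin_le (Nat.lt_succ_iff.1 hmn)) (hπ.adjoin_le k.le_succ),
    relTrace_torsion hK hf hπ (hm.trans (Nat.lt_succ_iff.1 hmn)),
    relTrace_algebraMap hK hf hπ hm (Nat.lt_succ_iff.1 hmn), Nat.add_sub_cancel]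

theorem norm_gen_lt_one (hf : IsFrobeniusLift f) (hπ : IsTorsionSequence σ f π) (k : ℕ) :
    ‖AdjoinSimple.gen K (π k)‖ < 1 := hπ.norm_lt_one hf k

/-- The constant contributes p^d · a/p. The torsion point contributes p^i from K(π_n) down to
K(π_{n-i}), then -a from one step, then p^{d-1-i}. Here i < d guarantees that step, and d < n keeps
the bottom level at least 1. -/
theorem relTrace_sum_smul_value {P : ℤ_[p][X]} (hK : IsUnramified K) (hf : IsFrobeniusLift f)
    (hπ : IsTorsionSequence σ f π) {n d : ℕ} (hn : d < n) {i : ℕ} (hi : i < d) :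
    relTrace (hπ.adjoin_le (n.sub_le d)) (b P 0 • (algebraMap K K⟮π n⟯
        ((σ ^ (-((n - i : ℕ) : ℤ)) : K ≃ₐ[ℚ_[p]] K) (f.coeff (p - 1)) / (p : K)) +
      inclusion (hπ.adjoin_le (n.sub_le i)) (AdjoinSimple.gen K (π (n - i))))) = 0 := by
  have hp : (p : ℚ_[p]) ≠ 0 := Nat.cast_ne_zero.2 (Fact.out : p.Prime).ne_zero
  have hdi : n - d ≤ n - i := by omega
  rw [relTrace_smul_padic, relTrace_add, relTrace_algebraMap hK hf hπ (by omega) (n.sub_le d),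
    relTrace_inclusion_torsion hK hf hπ (by omega) hdi (n.sub_le i),
    relTrace_gen_torsion hK hf hπ (by omega) (by omega : n - d < n - i), smul_smul, ← pow_add,
    show n - (n - d) = d by omega, show n - (n - i) + (n - i - 1 - (n - d)) = d - 1 by omega]
  set a := (σ ^ (-((n - i : ℕ) : ℤ)) : K ≃ₐ[ℚ_[p]] K) (f.coeff (p - 1))
  have ha : a / (p : K) = (p : ℚ_[p])⁻¹ • a := by
    rw [Algebra.smul_def, map_inv₀, map_natCast, div_eq_inv_mul]
  have hsmul (c : ℚ_[p]) (x : K) :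
      algebraMap K K⟮π (n - d)⟯ (c • x) = c • algebraMap K K⟮π (n - d)⟯ x := rfl
  obtain ⟨e, rfl⟩ := Nat.exists_eq_add_of_le' (Nat.zero_lt_of_lt hi)
  rw [ha, hsmul, smul_smul, pow_succ, mul_assoc, mul_inv_cancel₀ hp, mul_one, Nat.add_sub_cancel,
    map_neg, smul_neg, add_neg_cancel, smul_zero]

variable [FiniteDimensional ℚ_[p] K]

theorem sum_smul_value {P : ℤ_[p][X]} (hP : IsAdmissible P) (hf : IsFrobeniusLift f)
    (hπ : IsTorsionSequence σ f π) {n : ℕ} (hn : P.natDegree < n) {i : ℕ} (hi : i < P.natDegree) :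
    ∑ s ∈ Finset.range (P.natDegree + 1), b P s • value σ P f (-(n : ℤ) + s) i
      (inclusion (hπ.adjoin_le (n.sub_le s)) (AdjoinSimple.gen K (π (n - s)))) =
    b P 0 • (algebraMap K K⟮π n⟯
        ((σ ^ (-((n - i : ℕ) : ℤ)) : K ≃ₐ[ℚ_[p]] K) (f.coeff (p - 1)) / (p : K)) +
      inclusion (hπ.adjoin_le (n.sub_le i)) (AdjoinSimple.gen K (π (n - i)))) := by
  set y : ℕ → K⟮π n⟯ := fun j =>
    inclusion (hπ.adjoin_le (n.sub_le j)) (AdjoinSimple.gen K (π (n - j))) with hy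
  have hchain (j : ℕ) (hj : j < P.natDegree) :
      Polynomial.aeval (y j) (twist σ (-(n : ℤ) + j) f) = y (j + 1) := by
    have h := hπ.eval (n - j) (by omega)
    -- The exponent -(n - j) of the torsion sequence is the exponent m + j of the chain with m = -n.
    rw [show (-((n - j : ℕ) : ℤ)) = -(n : ℤ) + j by omega, Nat.sub_sub] at h
    refine Subtype.ext (Eq.trans ?_ h)
    exact (Polynomial.aeval_algHom_apply K⟮π n⟯.val (y j) _).symm
  have h1 := sum_smul_tsum_phiL hP hf σ (-(n : ℤ)) hi.le (y := y)
    (fun j => hπ.norm_lt_one hf (n - j)) hchain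
  have h2 := congrArg (algebraMap K K⟮π n⟯)
    (sum_smul_eps hP (Nat.zero_lt_of_lt hi) σ f (-((n - i : ℕ) : ℤ)))
  have hsmul (c : ℚ_[p]) (a : K) : algebraMap K K⟮π n⟯ (c • a) = c • algebraMap K K⟮π n⟯ a := rfl
  simp only [map_sum, hsmul] at h2
  rw [smul_add, ← h2, ← h1, ← Finset.sum_add_distrib]
  refine Finset.sum_congr rfl fun s _ => ?_
  rw [value, smul_add, show -(n : ℤ) + s + i = -((n - i : ℕ) : ℤ) + s by omega]

end TraceRelation

end Lubin

end

theorem proposition2 {p : ℕ} [Fact p.Prime]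
    (K : IntermediateField ℚ_[p] (PadicAlgCl p)) [FiniteDimensional ℚ_[p] K]
    (hK : Lubin.IsUnramified K)
    (σ : K ≃ₐ[ℚ_[p]] K) (hσ : Lubin.IsFrobenius σ)
    (P : ℤ_[p][X]) (hP : Lubin.IsAdmissible P) (d : ℕ) (hd : P.natDegree = d)
    (f : K[X]) (hf : Lubin.IsFrobeniusLift f)
    (π : ℕ → PadicAlgCl p) (hπ : Lubin.IsTorsionSequence σ f π)
    (n : ℕ) (hn : d < n) (i : ℕ) (hi : i < d) :
    -- all the series in the definitions converge
    (∀ x : K, Summable (Lubin.geomTerm σ P x)) ∧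
    (∀ m : ℤ, Summable (Lubin.epsTerm σ P f m)) ∧
    (∀ N : ℕ, Summable fun k => PowerSeries.coeff N (Lubin.lTerm σ P f k)) ∧
    (∀ s : ℕ, s ≤ d → Summable
      (Lubin.substTerm (Lubin.phiL σ P f (-(n : ℤ) + s) i)
        (IntermediateField.AdjoinSimple.gen K (π (n - s))))) ∧
    -- the trace relation, in `K(π_{n-d})`
    ∑ s : Fin (d + 1), ((p : ℚ_[p]) ^ (s : ℕ) * Lubin.b P s) •
      Lubin.Tr hπ (Nat.sub_le_sub_left (Nat.le_of_lt_succ s.isLt) n)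
        (Lubin.value σ P f (-(n : ℤ) + (s : ℕ)) i
          (IntermediateField.AdjoinSimple.gen K (π (n - s)))) = 0 := by
  have hsummable (s : ℕ) : Summable
      (Lubin.substTerm (Lubin.phiL σ P f (-(n : ℤ) + s) i)
        (IntermediateField.AdjoinSimple.gen K (π (n - s)))) :=
    Lubin.summable_substTerm (Lubin.convergesOnDisc_phiL hP hf σ _ i)
      (Lubin.norm_gen_lt_one hf hπ (n - s))
  subst hd
  refine ⟨Lubin.summable_geomTerm hP σ, Lubin.summable_epsTerm hP (Nat.zero_lt_of_lt hi) σ f,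
    Lubin.summable_coeff_lTerm hP hf σ, fun s _ => hsummable s, ?_⟩
  -- The right-hand 0 is rewritten as the trace from K(π_n) of the untraced relation, leaving a
  -- termwise comparison.
  rw [← Lubin.relTrace_sum_smul_value (P := P) hK hf hπ hn hi, ← Lubin.sum_smul_value hP hf hπ hn hi,
    Lubin.relTrace_sum, Finset.sum_range]
  refine Finset.sum_congr rfl fun s _ => ?_
  have hs := Nat.le_of_lt_succ s.isLt
  -- The s-th value already lies in K(π_{n-s}), so tracing it from K(π_n) gives the factor p^s.
  rw [Lubin.relTrace_smul_padic, ← Lubin.inclusion_value _ (hsummable s),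
    Lubin.relTrace_inclusion_torsion hK hf hπ (by omega) (Nat.sub_le_sub_left hs n) (n.sub_le s),
    smul_smul, show n - (n - (s : ℕ)) = s by omega, mul_comm]
  rfl
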